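/- **Setting.** Let $\mathcal X,\Omega$ be finite non-empty sets and let $k^{(f)},k^{(g)}$ be positive semidefinite kernels on $\mathcal X\times\Omega$. Let $f,g:\mathcal X\times\Omega\to\mathbb R$ be random functions, $f\sim\mathcal{GP}(0,k^{(f)})$ and $g\sim\mathcal{GP}(0,k^{(g)})$, with $k^{(f)}(z,z)\le 1$ and $k^{(g)}(z,z)\le1$ for all $z\in\mathcal X\times\Omega$, and $\sigma_{0,\min}^{(g)2}:=\min_z k^{(g)}(z,z)>0$. In trial $t=1,2,\dots$ a design point $x_t\in\mathcal X$ is chosen, $w_t$ is drawn from an unknown distribution $p^\dagger$ on $\Omega$ (uncontrollable setting), and one observes $y^{(f)}_t=f(x_t,w_t)+\varepsilon_{f,t}$ and $y^{(g)}_t=g(x_t,w_t)+\varepsilon_{g,t}$, where $\varepsilon_{f,t}\sim N(0,\sigma_{f,\rm noise}^2)$ and $\varepsilon_{g,t}\sim N(0,\sigma^2_{g,\rm noise})$ with positive variances; the $w_t$, the noises $\varepsilon_{f,t}$, $\varepsilon_{g,t}$, the pair $(f,g)$ and the internal randomness of the algorithm are mutually independent. Assume $p_{\min}:=\min_{w}p^\dagger(w)>0$.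 **Parameters.** Let $h\in\mathbb R$, $\alpha\in(0,1)$, $\delta\in(0,1)$, $\xi>0$, and $$\beta_t=2\log\frac{2|\mathcal X\times\Omega|\pi^2t^2}{3\delta},\qquad \eta=\min\left\{\frac{\xi\sigma^{(g)}_{0,\min}}2,\ \frac{\xi^2\delta\,\sigma^{(g)}_{0,\min}}{8|\mathcal X\times\Omega|}\right\}.$$ For $t\ge1$ let $\mathcal A_t=\{p \text{ a probability function on }\Omega:\ d(p,p^*_t)\le\epsilon_t\}$ with a user-specified reference distribution $p_t^*$ (which may depend on the data), a distance function $d$ (only $d(p,p)=0$ is used), and $\epsilon_t>0$. **Algorithm.** With the Gaussian process posterior means $\mu_t^{(f)},\mu_t^{(g)}$ and standard deviations $\sigma^{(f)}_t,\sigma_t^{(g)}$ after $t$ trials put $l^{(f)}_t=\mu^{(f)}_t-\beta_t^{1/2}\sigma^{(f)}_t$ and $u^{(f)}_t=\mu^{(f)}_t+\beta_t^{1/2}\sigma^{(f)}_t$, and likewise $l_t^{(g)},u_t^{(g)}$. Let $[l^{(1)}_t,u^{(1)}_t]$ be $[1,1]$ if $l_t^{(g)}>h-\eta$, $[0,1]$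 if $l_t^{(g)}\le h-\eta$ and $u^{(g)}_t>h$, and $[0,0]$ otherwise. Put $$l^{F}_t(x)=\inf_{p\in\mathcal A_t}\sum_w l^{(f)}_t(x,w)p(w),\quad u^{F}_t(x)=\inf_{p\in\mathcal A_t}\sum_w u^{(f)}_t(x,w)p(w),$$ $$l^{G}_t(x)=\inf_{p\in\mathcal A_t}\sum_w l^{(1)}_t(x,w)p(w),\quad u^{G}_t(x)=\inf_{p\in\mathcal A_t}\sum_w u^{(1)}_t(x,w)p(w),$$ $$H_t=\{x: l_t^G(x)>\alpha-\xi\},\quad L_t=\{x: l_t^G(x)\le\alpha-\xi,\ u_t^G(x)\le\alpha\},\quad M_t=\{x: l_t^G(x)\le\alpha-\xi,\ u_t^G(x)>\alpha\}.$$ Let $c_t$ be $\max_{H_t}l^F_t$ if $H_t\ne\emptyset$, $\min_{M_t}l^F_t$ if $H_t=\emptyset\ne M_t$, and $\min_{\mathcal X}l^F_t$ otherwise. Let $a_t(x)=\max\{u^F_t(x)-c_t,0\}\cdot a^G_t(x)$, where $a_t^G(x)$ is $1$ on $H_t$, $\frac{u^G_t(x)-(\alpha-\xi)}{u^G_t(x)-l^G_t(x)}$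 on $M_t$, and $0$ on $L_t$. The algorithm stops after trial $t\ge1$ if (S1) $L_t=\mathcal X$, or (S2) $H_t\neq\emptyset$ and $\max_{H_t\cup M_t}u^F_t-\max_{H_t}l^F_t<\xi$; otherwise $x_{t+1}$ is a maximizer of $a_t$ over $H_t\cup M_t$. The first point $x_1$ is arbitrary. Every $x_t$ (including the choice among several maximizers) is determined by the data of the first $t-1$ trials and the internal randomness of the algorithm. **Information gain.** Let $\kappa^{(f)}_T=\max I(y;f)$, the maximum over all $z_1,\dots,z_T\in\mathcal X\times\Omega$ (repetitions allowed) of the mutual information between $f\sim\mathcal{GP}(0,k^{(f)})$ and $y=(f(z_i)+\varepsilon_i)_{i\le T}$ with independent $\varepsilon_i\sim N(0,\sigma^2_{f,\rm noise})$; define $\kappa^{(g)}_T$ likewise from $k^{(g)}$ and $\sigma^2_{g,\rm noise}$. **Theorem.** Let $T$ be the smallest positive integer with $$\frac{\beta_{T^2}\bigl(C_{2,f}\,\kappa_T^{(f)}+C_{2,g}\,\kappa_T^{(g)}+C_3\bigr)}{T}<\min\left\{\frac{\xi^4}4,\frac{\eta^2}4\right\},$$ where $C_{2,f}=\dfrac{4p_{\min}^{-1}}{\log(1+\sigma_{f,\rm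 noise}^{-2})}$, $C_{2,g}=\dfrac{4p_{\min}^{-1}}{\log(1+\sigma_{g,\rm noise}^{-2})}$ and $C_3=16\,p_{\min}^{-1}\log(5/\delta)$. Then, with probability at least $1-\delta$, the algorithm terminates after at most $T^2$ trials. -/

import Mathlib

open MeasureTheory ProbabilityTheory
open scoped NNReal ENNReal Matrix

noncomputable section

namespace DRCCBO

/-! ### Information gain of a Gaussian process -/

/-- Mutual information of a pair of random elements with joint law `ρ`: the Kullback-Leibler
divergence (in nats) of the joint law from the product of its marginals. -/
def mutualInformation {A B : Type*} [MeasurableSpace A] [MeasurableSpace B]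
    (ρ : Measure (A × B)) : ℝ≥0∞ :=
  InformationTheory.klDiv ρ (ρ.fst.prod ρ.snd)

/-- Joint law of `(y, f)`, where `f` is a centred Gaussian process with covariance kernel `k` on the
finite index set `ι`, and `y i = f (a i) + e i` with independent `N(0, v)` noises `e i`. -/
def observationLaw {ι : Type*} [Fintype ι] [DecidableEq ι] (k : ι → ι → ℝ) (v : ℝ≥0) {T : ℕ}
    (a : Fin T → ι) : Measure ((Fin T → ℝ) × EuclideanSpace ℝ ι) :=
  ((multivariateGaussian 0 (Matrix.of k)).prod
      (Measure.pi fun _ : Fin T => gaussianReal 0 v)).map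
    fun q => (fun i => q.1 (a i) + q.2 i, q.1)

/-- Maximum information gain `κ_T`: the maximum of `I(y ; f)` over all choices of `T` observation
points (the same point may be observed several times, as in the algorithm). -/
def maxInfoGain {ι : Type*} [Fintype ι] [DecidableEq ι] (k : ι → ι → ℝ) (v : ℝ≥0) (T : ℕ) : ℝ :=
  ⨆ a : Fin T → ι, (mutualInformation (observationLaw k v a)).toReal

/-! ### Gaussian process posterior -/

/-- The matrix `K_t + v I_t`. -/
def noisyGram {ι : Type*} (k : ι → ι → ℝ) (v : ℝ≥0) {t : ℕ} (z : Fin t → ι) :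
    Matrix (Fin t) (Fin t) ℝ :=
  Matrix.of (fun i j => k (z i) (z j)) + (v : ℝ) • (1 : Matrix (Fin t) (Fin t) ℝ)

/-- Posterior mean at `q` after observing the values `y` at the points `z`. -/
def postMean {ι : Type*} (k : ι → ι → ℝ) (v : ℝ≥0) {t : ℕ} (z : Fin t → ι) (y : Fin t → ℝ)
    (q : ι) : ℝ :=
  (fun i => k q (z i)) ⬝ᵥ ((noisyGram k v z)⁻¹ *ᵥ y)

/-- Posterior variance at `q` after observing values at the points `z`. -/
def postVar {ι : Type*} (k : ι → ι → ℝ) (v : ℝ≥0) {t : ℕ} (z : Fin t → ι) (q : ι) : ℝ :=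
  k q q - (fun i => k q (z i)) ⬝ᵥ ((noisyGram k v z)⁻¹ *ᵥ (fun i => k q (z i)))

/-! ### Parameters of the algorithm and credible intervals -/

/-- The inputs of the algorithm: kernels, noise variances, threshold `h`, level `alpha`,
accuracy `xi`, confidence `delta`, distance function between distributions, and radii `eps t`. -/
structure Params (X Om : Type*) where
  kf : X × Om → X × Om → ℝ
  kg : X × Om → X × Om → ℝ
  varf : ℝ≥0
  varg : ℝ≥0
  h : ℝ
  alpha : ℝ
  xi : ℝ
  delta : ℝ
  dist : (Om → ℝ) → (Om → ℝ) → ℝ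
  eps : ℕ → ℝ

/-- The data after `t` trials. -/
structure Data (X Om : Type*) (t : ℕ) where
  pt : Fin t → X × Om
  yf : Fin t → ℝ
  yg : Fin t → ℝ

/-- Worst-case expectation of `v` over a family `A` of probability functions. -/
def worstCase {Om : Type*} [Fintype Om] (A : Set (Om → ℝ)) (v : Om → ℝ) : ℝ :=
  sInf ((fun p : Om → ℝ => ∑ w, v w * p w) '' A)

section Algorithm

variable {X Om : Type*} [Fintype X] [Fintype Om] (c : Params X Om)

/-- `β_t = 2 log (2 |X × Ω| π² t² / (3 δ))`. -/
def beta (t : ℕ) : ℝ :=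
  2 * Real.log (2 * (Fintype.card (X × Om) : ℝ) * Real.pi ^ 2 * (t : ℝ) ^ 2 / (3 * c.delta))

/-- `min_{(x,w)} σ_0^{(g)2}(x,w)`. -/
def sigmaGMinSq : ℝ := ⨅ z : X × Om, c.kg z z

/-- The overestimation parameter `η`. -/
def eta : ℝ :=
  min (c.xi * √(sigmaGMinSq c) / 2)
    (c.xi ^ 2 * c.delta * √(sigmaGMinSq c) / (8 * (Fintype.card (X × Om) : ℝ)))

/-- The candidate family `A_t` around the reference distribution `pstar`. -/
def candidates (t : ℕ) (pstar : Om → ℝ) : Set (Om → ℝ) :=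
  {p | p ∈ stdSimplex ℝ Om ∧ c.dist p pstar ≤ c.eps t}

variable {t : ℕ} (D : Data X Om t) (pstar : Om → ℝ)

/-- `l_t^{(f)}`. -/
def lf (x : X) (w : Om) : ℝ :=
  postMean c.kf c.varf D.pt D.yf (x, w) - √(beta c t) * √(postVar c.kf c.varf D.pt (x, w))

/-- `u_t^{(f)}`. -/
def uf (x : X) (w : Om) : ℝ :=
  postMean c.kf c.varf D.pt D.yf (x, w) + √(beta c t) * √(postVar c.kf c.varf D.pt (x, w))

/-- `l_t^{(g)}`. -/
def lg (x : X) (w : Om) : ℝ :=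
  postMean c.kg c.varg D.pt D.yg (x, w) - √(beta c t) * √(postVar c.kg c.varg D.pt (x, w))

/-- `u_t^{(g)}`. -/
def ug (x : X) (w : Om) : ℝ :=
  postMean c.kg c.varg D.pt D.yg (x, w) + √(beta c t) * √(postVar c.kg c.varg D.pt (x, w))

open Classical in
/-- Lower end of the credible interval of `1[g(x,w) > h]`. -/
def lInd (x : X) (w : Om) : ℝ := if lg c D x w > c.h - eta c then 1 else 0

open Classical in
/-- Upper end of the credible interval of `1[g(x,w) > h]`. -/
def uInd (x : X) (w : Om) : ℝ :=
  if lg c D x w > c.h - eta c then 1 else if ug c D x w > c.h then 1 else 0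

/-- `l_t^{(F_t)}`. -/
def lF (x : X) : ℝ := worstCase (candidates c t pstar) (lf c D x)

/-- `u_t^{(F_t)}`. -/
def uF (x : X) : ℝ := worstCase (candidates c t pstar) (uf c D x)

/-- `l_t^{(G_t)}`. -/
def lG (x : X) : ℝ := worstCase (candidates c t pstar) (lInd c D x)

/-- `u_t^{(G_t)}`. -/
def uG (x : X) : ℝ := worstCase (candidates c t pstar) (uInd c D x)

/-- `H_t`. -/
def setH : Set X := {x | lG c D pstar x > c.alpha - c.xi}

/-- `L_t`. -/
def setL : Set X := {x | lG c D pstar x ≤ c.alpha - c.xi ∧ uG c D pstar x ≤ c.alpha}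

/-- `M_t`. -/
def setM : Set X := {x | lG c D pstar x ≤ c.alpha - c.xi ∧ uG c D pstar x > c.alpha}

open Classical in
/-- The current best value `c_t^{(best)}`. -/
def cBest : ℝ :=
  if (setH c D pstar).Nonempty then sSup (lF c D pstar '' setH c D pstar)
  else if (setM c D pstar).Nonempty then sInf (lF c D pstar '' setM c D pstar)
  else ⨅ x, lF c D pstar x

/-- `a_t^{(F_t)}`. -/
def acqF (x : X) : ℝ := max (uF c D pstar x - cBest c D pstar) 0

open Classical in
/-- `a_t^{(G_t)}`. -/
def acqG (x : X) : ℝ :=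
  if x ∈ setH c D pstar then 1
  else if x ∈ setM c D pstar then
    (uG c D pstar x - (c.alpha - c.xi)) / (uG c D pstar x - lG c D pstar x)
  else 0

/-- The acquisition function `a_t`. -/
def acq (x : X) : ℝ := acqF c D pstar x * acqG c D pstar x

/-- Stopping condition (S1). -/
def stopS1 : Prop := setL c D pstar = Set.univ

/-- Stopping condition (S2). -/
def stopS2 : Prop :=
  (setH c D pstar).Nonempty ∧
    sSup (uF c D pstar '' (setH c D pstar ∪ setM c D pstar)) -
      sSup (lF c D pstar '' setH c D pstar) < c.xi

end Algorithm

/-! ### The observation model and the runs of the algorithm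

Trials are indexed from `0`: `x t`, `w t`, `ef t`, `eg t` belong to trial number `t + 1`. -/

/-- The independent sources of randomness: the functions `(f, g)`, an external seed for random
choices of the algorithm (initial point, ties), the environment and the noises of each trial. -/
inductive Source where
  | latent : Source
  | seed : Source
  | env (t : ℕ) : Source
  | noiseF (t : ℕ) : Source
  | noiseG (t : ℕ) : Source

section Model

variable {S X Om U : Type*} [MeasurableSpace S] [MeasurableSpace X] [MeasurableSpace Om]
  [MeasurableSpace U]

/-- The sigma-algebra generated by each source. -/
@[reducible]
def sourceSigma (f g : X × Om → S → ℝ) (seed : S → U) (w : ℕ → S → Om) (ef eg : ℕ → S → ℝ) :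
    Source → MeasurableSpace S
  | .latent => MeasurableSpace.comap (fun s => ((fun z => f z s), (fun z => g z s)))
      (inferInstance : MeasurableSpace ((X × Om → ℝ) × (X × Om → ℝ)))
  | .seed => MeasurableSpace.comap seed inferInstance
  | .env t => MeasurableSpace.comap (w t) inferInstance
  | .noiseF t => MeasurableSpace.comap (ef t) inferInstance
  | .noiseG t => MeasurableSpace.comap (eg t) inferInstance

/-- `f ~ GP(0, k)` under `P`. -/
structure IsCentredGP {ι : Type*} (f : ι → S → ℝ) (k : ι → ι → ℝ) (P : Measure S) : Prop where
  measurable : ∀ z, Measurable (f z)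
  gaussian : IsGaussianProcess f P
  mean : ∀ z, ∫ s, f z s ∂P = 0
  cov : ∀ z z', cov[f z, f z'; P] = k z z'

/-- The probabilistic model in the uncontrollable setting: `f` and `g` are Gaussian processes, the
environmental variables are drawn from `pdag` and the noises are Gaussian, all independent. -/
structure UncontrollableModel (c : Params X Om) (pdag : Om → ℝ) (P : Measure S)
    (f g : X × Om → S → ℝ) (seed : S → U) (w : ℕ → S → Om) (ef eg : ℕ → S → ℝ) : Prop where
  gp_f : IsCentredGP f c.kf P
  gp_g : IsCentredGP g c.kg P
  measurable_seed : Measurable seed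
  measurable_w : ∀ t, Measurable (w t)
  measurable_ef : ∀ t, Measurable (ef t)
  measurable_eg : ∀ t, Measurable (eg t)
  law_w : ∀ t o, P (w t ⁻¹' {o}) = ENNReal.ofReal (pdag o)
  law_ef : ∀ t, P.map (ef t) = gaussianReal 0 c.varf
  law_eg : ∀ t, P.map (eg t) = gaussianReal 0 c.varg
  indep : iIndep (sourceSigma f g seed w ef eg) P

/-- The data after `t` trials in the outcome `s`. -/
def dataAt (f g : X × Om → S → ℝ) (w : ℕ → S → Om) (ef eg : ℕ → S → ℝ) (x : ℕ → S → X)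
    (t : ℕ) (s : S) : Data X Om t where
  pt i := (x i s, w i s)
  yf i := f (x i s, w i s) s + ef i s
  yg i := g (x i s, w i s) s + eg i s

/-- The information available to the algorithm after `t` trials: its seed and the data. -/
@[reducible]
def dataSigma (f g : X × Om → S → ℝ) (seed : S → U) (w : ℕ → S → Om) (ef eg : ℕ → S → ℝ)
    (x : ℕ → S → X) (t : ℕ) : MeasurableSpace S :=
  MeasurableSpace.comap
    (fun s => (seed s, (dataAt f g w ef eg x t s).pt, (dataAt f g w ef eg x t s).yf,
      (dataAt f g w ef eg x t s).yg))
    (inferInstance : MeasurableSpace (U × (Fin t → X × Om) × (Fin t → ℝ) × (Fin t → ℝ)))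

variable [Fintype X] [Fintype Om]

/-- One of the stopping conditions holds after `t` trials in the outcome `s`; `pstar t s` is the
reference distribution. -/
def StopsAt (c : Params X Om) (f g : X × Om → S → ℝ) (w : ℕ → S → Om) (ef eg : ℕ → S → ℝ)
    (x : ℕ → S → X) (pstar : ℕ → S → Om → ℝ) (t : ℕ) (s : S) : Prop :=
  stopS1 c (dataAt f g w ef eg x t s) (pstar t s) ∨
    stopS2 c (dataAt f g w ef eg x t s) (pstar t s)

/-- `x` is the sequence of design points of the algorithm. Every point is chosen from
the available information; the first one is arbitrary, and as long as the algorithm has not stopped,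
the next one maximizes the acquisition function `a_t` over `H_t ∪ M_t`. -/
structure IsRun (c : Params X Om) (f g : X × Om → S → ℝ) (seed : S → U) (w : ℕ → S → Om)
    (ef eg : ℕ → S → ℝ) (x : ℕ → S → X) (pstar : ℕ → S → Om → ℝ) : Prop where
  adapted : ∀ t, Measurable[dataSigma f g seed w ef eg x t] (x t)
  mem : ∀ t s, 1 ≤ t → (∀ r, 1 ≤ r → r ≤ t → ¬ StopsAt c f g w ef eg x pstar r s) →
    x t s ∈ setH c (dataAt f g w ef eg x t s) (pstar t s) ∪
      setM c (dataAt f g w ef eg x t s) (pstar t s)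
  maximizes : ∀ t s, 1 ≤ t → (∀ r, 1 ≤ r → r ≤ t → ¬ StopsAt c f g w ef eg x pstar r s) →
    IsMaxOn (acq c (dataAt f g w ef eg x t s) (pstar t s))
      (setH c (dataAt f g w ef eg x t s) (pstar t s) ∪
        setM c (dataAt f g w ef eg x t s) (pstar t s)) (x t s)

end Model

/-! ### The sample-size condition -/

section Budget

variable {X Om : Type*} [Fintype X] [Fintype Om] [DecidableEq X] [DecidableEq Om]

/-- `p_min`. -/
def pMin (pdag : Om → ℝ) : ℝ := ⨅ o, pdag o

/-- The constant `4 p_min⁻¹ / log (1 + v⁻¹)` for the noise variance `v`. -/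
def constC2 (pdag : Om → ℝ) (v : ℝ≥0) : ℝ :=
  4 * (pMin pdag)⁻¹ / Real.log (1 + (v : ℝ)⁻¹)

/-- The constant `16 p_min⁻¹ log (5 / δ)`. -/
def constC3 (pdag : Om → ℝ) (delta : ℝ) : ℝ := 16 * (pMin pdag)⁻¹ * Real.log (5 / delta)

/-- The inequality that determines `T`. -/
def BudgetSuffices (c : Params X Om) (pdag : Om → ℝ) (T : ℕ) : Prop :=
  beta c (T ^ 2) *
      (constC2 pdag c.varf * maxInfoGain c.kf c.varf T +
        constC2 pdag c.varg * maxInfoGain c.kg c.varg T + constC3 pdag c.delta) / (T : ℝ) <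
    min (c.xi ^ 4 / 4) (eta c ^ 2 / 4)

end Budget

end DRCCBO

end

/-!
As long as the algorithm runs, the point it selects carries a large posterior variance, while the
information gain limits the sum of the posterior variances that can be met along a sequence of
points. The theorem compares the two. Posterior variances depend on the sampled points only, so the
one probabilistic ingredient is the draw of the environment in each trial.

*Selected points are uncertain* (`exists_le_beta_mul_postVar`). If the selected point lies in `M_t`,
the lower and upper indicator bounds differ for some `w`, so the credible interval of `g` there is
longer than `η`. If it lies in `H_t`, then, since (S2) fails, some point has acquisition value at
least `ξ min(1, ξ)`, and so has the maximizer; this bounds the width `u^F - l^F` from below, hence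
the width of a credible interval of `f`. Either way `β_t (σ_f² + σ_g²)` is at least
`min(ξ⁴/4, η²/4)` for some `w`.

*Expected against realized variances* (`exists_event_sum_condExp_le`). The environment `w_t` is
independent of the past and puts mass at least `p_min` on every value, so the conditional expectation
of `σ_f² + σ_g²` over `w_t` is at least `p_min` times the maximum over `w`. By an exponential
supermartingale and Markov's inequality, with probability at least `1 - δ` the sum of the conditional
expectations is at most twice the realized sum plus `4 log (1/δ)`.

*Realized variances against information* (`sum_postVar_le`). The mutual information of `y` and `f`
is half the log-determinant of `K / v + I` (`toReal_mutualInformation_observationLaw`), which by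
Schur complements is `½ ∑ log (1 + σ_t² / v)`; this dominates a multiple of `∑ σ_t²`, the variances
being at most one. Fischer's inequality makes the maximum information gain subadditive, so that
`κ_{T²} ≤ T κ_T`.

If the algorithm had not stopped after `T²` trials on the good event, these bounds would contradict
the sample-size condition (`not_budgetSuffices_of_sum_ge`).
-/

noncomputable section

namespace DRCCBO

/-! ### Determinants of positive definite matrices -/

section Determinants

variable {m : Type*} [Fintype m] [DecidableEq m]

lemma one_le_det_one_add {Q : Matrix m m ℝ} (hQ : Q.PosSemidef) : 1 ≤ (1 + Q).det := by
  have hH : (1 + Q).IsHermitian := (Matrix.PosDef.one.add_posSemidef hQ).isHermitian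
  rw [hH.det_eq_prod_eigenvalues]
  have h1 : ∀ i, 1 ≤ hH.eigenvalues i := by
    intro i
    rw [hH.eigenvalues_eq, Matrix.add_mulVec, dotProduct_add, Matrix.one_mulVec]
    have h2 := hQ.re_dotProduct_nonneg (hH.eigenvectorBasis i).ofLp
    have h3 : star (hH.eigenvectorBasis i).ofLp ⬝ᵥ (hH.eigenvectorBasis i).ofLp = (1 : ℝ) := by
      have := hH.eigenvectorBasis.orthonormal.1 i
      rw [EuclideanSpace.norm_eq, Real.sqrt_eq_one] at this
      rw [← this]
      simp [dotProduct, sq]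
    rw [h3]
    simpa using h2
  simpa using Finset.prod_le_prod (s := Finset.univ) (f := fun _ : m => (1 : ℝ))
    (fun _ _ => zero_le_one) (fun i _ => h1 i)

open scoped MatrixOrder in
/-- The determinant is monotone in the Loewner order. -/
lemma det_le_det_add {A Q : Matrix m m ℝ} (hA : A.PosDef) (hQ : Q.PosSemidef) :
    A.det ≤ (A + Q).det := by
  set R := CFC.sqrt A with hR
  have hRR : R * R = A := CFC.sqrt_mul_sqrt_self _ hA.posSemidef.nonneg
  have hdet : R.det * R.det = A.det := by rw [← hRR, Matrix.det_mul]
  have hu : IsUnit R.det := by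
    refine isUnit_iff_ne_zero.2 fun h => ?_
    have := hA.det_pos
    rw [← hdet, h] at this
    simp at this
  have hRh : R.IsHermitian := (Matrix.nonneg_iff_posSemidef.1 (CFC.sqrt_nonneg A)).isHermitian
  -- `A + Q = R (1 + R⁻¹ Q R⁻¹) R`, and the middle factor has determinant at least one
  have hP : (R⁻¹ * Q * R⁻¹).PosSemidef := by
    have := hQ.mul_mul_conjTranspose_same R⁻¹
    rwa [Matrix.conjTranspose_nonsing_inv, hRh.eq] at this
  have hfac : A + Q = R * (1 + R⁻¹ * Q * R⁻¹) * R := by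
    rw [Matrix.mul_add, Matrix.add_mul, mul_one, hRR]
    congr 1
    rw [← Matrix.mul_assoc, ← Matrix.mul_assoc, Matrix.mul_nonsing_inv _ hu, one_mul,
      Matrix.mul_assoc, Matrix.nonsing_inv_mul _ hu, mul_one]
  rw [hfac, Matrix.det_mul, Matrix.det_mul]
  have := one_le_det_one_add hP
  nlinarith [hA.det_pos]

end Determinants

/-! ### Gram matrices and posterior variances -/

section Posterior

variable {ι : Type*} {k : ι → ι → ℝ} {v : ℝ≥0}

/-- Covariances between the points `a` and the points `b`. -/
def crossCov (k : ι → ι → ℝ) {m n : ℕ} (a : Fin m → ι) (b : Fin n → ι) :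
    Matrix (Fin m) (Fin n) ℝ :=
  Matrix.of fun i j => k (a i) (b j)

lemma kernel_comm (hk : (Matrix.of k).PosSemidef) (p q : ι) : k p q = k q p := by
  have := hk.isHermitian.apply q p
  simpa using this

lemma posDef_noisyGram (hk : (Matrix.of k).PosSemidef) (hv : 0 < v) {t : ℕ} (z : Fin t → ι) :
    (noisyGram k v z).PosDef :=
  (Matrix.PosDef.one.smul (NNReal.coe_pos.2 hv)).posSemidef_add (hk.submatrix z)

lemma crossCov_conjTranspose (hk : (Matrix.of k).PosSemidef) {m n : ℕ} (a : Fin m → ι)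
    (b : Fin n → ι) : (crossCov k a b)ᴴ = crossCov k b a := by
  ext i j
  simp [crossCov, kernel_comm hk]

/-- The posterior covariance of the points `b` is positive semidefinite. -/
lemma posSemidef_schur (hk : (Matrix.of k).PosSemidef) (hv : 0 < v) {m n : ℕ} (a : Fin m → ι)
    (b : Fin n → ι) :
    (crossCov k b b - crossCov k b a * (noisyGram k v a)⁻¹ * crossCov k a b).PosSemidef := by
  have hA := posDef_noisyGram hk hv a
  have : Invertible (noisyGram k v a) := hA.isUnit.invertible
  have h1 : (Matrix.fromBlocks (noisyGram k v a) (crossCov k a b) (crossCov k a b)ᴴ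
      (crossCov k b b)).PosSemidef := by
    have h2 : (Matrix.fromBlocks (crossCov k a a) (crossCov k a b) (crossCov k b a)
      (crossCov k b b)).PosSemidef := by
      convert! hk.submatrix (Sum.elim a b) using 1
      ext (i | i) (j | j) <;> simp [crossCov]
    have h3 : (Matrix.fromBlocks ((v : ℝ) • (1 : Matrix (Fin m) (Fin m) ℝ)) 0 0
        (0 : Matrix (Fin n) (Fin n) ℝ)).PosSemidef := by
      convert! (Matrix.PosSemidef.diagonal (d := Sum.elim (fun _ : Fin m => (v : ℝ))
        (fun _ : Fin n => 0)) ?_) using 1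
      · ext (i | i) (j | j) <;> simp [Matrix.diagonal_apply, Matrix.one_apply]
      · rintro (i | i) <;> simp
    convert! h2.add h3 using 1
    rw [Matrix.fromBlocks_add, crossCov_conjTranspose hk]
    simp only [add_zero]
    rfl
  rw [Matrix.PosDef.fromBlocks₁₁ _ _ hA, crossCov_conjTranspose hk] at h1
  exact h1

/-- The Schur complement formula for the determinant of a Gram matrix. -/
lemma det_noisyGram_append (hk : (Matrix.of k).PosSemidef) (hv : 0 < v) {m n : ℕ}
    (a : Fin m → ι) (b : Fin n → ι) :
    (noisyGram k v (Fin.append a b)).det = (noisyGram k v a).det *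
      (noisyGram k v b - crossCov k b a * (noisyGram k v a)⁻¹ * crossCov k a b).det := by
  have hA := posDef_noisyGram hk hv a
  have : Invertible (noisyGram k v a) := hA.isUnit.invertible
  rw [← Matrix.invOf_eq_nonsing_inv, ← Matrix.det_fromBlocks₁₁,
    ← Matrix.det_submatrix_equiv_self finSumFinEquiv]
  congr 1
  ext (i | i) (j | j) <;>
    simp [noisyGram, crossCov, Matrix.one_apply, Fin.ext_iff]
  · intro h
    have := i.2
    omega
  · intro h
    have := j.2
    omega

/-- Fischer's inequality for Gram matrices. -/
lemma det_noisyGram_append_le (hk : (Matrix.of k).PosSemidef) (hv : 0 < v) {m n : ℕ}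
    (a : Fin m → ι) (b : Fin n → ι) :
    (noisyGram k v (Fin.append a b)).det ≤ (noisyGram k v a).det * (noisyGram k v b).det := by
  rw [det_noisyGram_append hk hv]
  refine mul_le_mul_of_nonneg_left ?_ (posDef_noisyGram hk hv a).det_pos.le
  set C := crossCov k b a * (noisyGram k v a)⁻¹ * crossCov k a b with hC
  have hCp : C.PosSemidef := by
    rw [hC, ← crossCov_conjTranspose hk a b]
    exact (posDef_noisyGram hk hv a).inv.posSemidef.conjTranspose_mul_mul_same _
  have hS : (noisyGram k v b - C).PosDef := by
    have := (Matrix.PosDef.one.smul (NNReal.coe_pos.2 hv)).posSemidef_add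
      (posSemidef_schur hk hv a b)
    convert! this using 1
    rw [hC, sub_add_eq_add_sub]
    rfl
  simpa using det_le_det_add hS hCp

lemma schur_singleton (t : ℕ) (z : Fin t → ι) (hk : (Matrix.of k).PosSemidef) (q : ι) :
    (crossCov k (fun _ : Fin 1 => q) z * (noisyGram k v z)⁻¹ *
      crossCov k z (fun _ : Fin 1 => q)) 0 0 =
      (fun i => k q (z i)) ⬝ᵥ ((noisyGram k v z)⁻¹ *ᵥ (fun i => k q (z i))) := by
  rw [Matrix.mul_assoc, Matrix.mul_apply, dotProduct]
  refine Finset.sum_congr rfl fun i _ => ?_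
  simp [crossCov, Matrix.mul_apply, Matrix.mulVec, dotProduct, kernel_comm hk q]

lemma postVar_nonneg (hk : (Matrix.of k).PosSemidef) (hv : 0 < v) {t : ℕ} (z : Fin t → ι)
    (q : ι) : 0 ≤ postVar k v z q := by
  have := (posSemidef_schur hk hv z (fun _ : Fin 1 => q)).diag_nonneg (i := 0)
  rw [Matrix.sub_apply, schur_singleton t z hk q] at this
  exact this

lemma postVar_le (hk : (Matrix.of k).PosSemidef) (hv : 0 < v) {t : ℕ} (z : Fin t → ι)
    (q : ι) : postVar k v z q ≤ k q q := by
  have := (posDef_noisyGram hk hv z).inv.posSemidef.re_dotProduct_nonneg (fun i => k q (z i))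
  simp only [star_trivial, RCLike.re_to_real] at this
  unfold postVar
  linarith

lemma det_noisyGram_append_singleton (hk : (Matrix.of k).PosSemidef) (hv : 0 < v) {t : ℕ}
    (z : Fin t → ι) (q : ι) :
    (noisyGram k v (Fin.append z (fun _ : Fin 1 => q))).det =
      (noisyGram k v z).det * (v + postVar k v z q) := by
  rw [det_noisyGram_append hk hv, Matrix.det_fin_one (_ - _), Matrix.sub_apply]
  congr 1
  rw [schur_singleton t z hk q]
  simp [noisyGram, postVar]
  ring

/-- The chain rule: the log-determinant adds up the contributions of the successive
posterior variances. -/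
lemma log_det_noisyGram_eq_sum (hk : (Matrix.of k).PosSemidef) (hv : 0 < v) (z : ℕ → ι) (N : ℕ) :
    Real.log (noisyGram k v (fun i : Fin N => z i)).det - N * Real.log v =
      ∑ t ∈ Finset.range N, Real.log (1 + postVar k v (fun i : Fin t => z i) (z t) / v) := by
  induction N with
  | zero => simp
  | succ t ih =>
    have hz : (fun i : Fin (t + 1) => z i) =
        Fin.append (fun i : Fin t => z i) (fun _ : Fin 1 => z t) := by
      ext i
      refine Fin.lastCases ?_ (fun j => ?_) i
      · rw [show Fin.last t = Fin.natAdd t (0 : Fin 1) from rfl, Fin.append_right]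
        simp
      · rw [show j.castSucc = Fin.castAdd 1 j from rfl, Fin.append_left]
        simp
    have hv' : (0 : ℝ) < v := NNReal.coe_pos.2 hv
    have hp := postVar_nonneg hk hv (fun i : Fin t => z i) (z t)
    rw [Finset.sum_range_succ, ← ih, hz, det_noisyGram_append_singleton hk hv,
      Real.log_mul (posDef_noisyGram hk hv _).det_pos.ne' (by positivity),
      show 1 + postVar k v (fun i : Fin t => z i) (z t) / v =
        (v + postVar k v (fun i : Fin t => z i) (z t)) / v by field_simp,
      Real.log_div (by positivity) hv'.ne']
    push_cast
    ring

/-- For `0 ≤ s ≤ 1`, concavity of the logarithm gives `s ≤ log (1 + s / v) / log (1 + 1 / v)`. -/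
lemma mul_log_le_log_one_add_div {v s : ℝ} (hv : 0 < v) (hs : 0 ≤ s) (hs1 : s ≤ 1) :
    s * Real.log (1 + v⁻¹) ≤ Real.log (1 + s / v) := by
  have h := strictConcaveOn_log_Ioi.concaveOn.2 (x := 1 + v⁻¹) (y := 1)
    (Set.mem_Ioi.2 (by positivity)) (Set.mem_Ioi.2 one_pos) hs (sub_nonneg.2 hs1) (by ring)
  simp only [smul_eq_mul, Real.log_one, mul_zero, add_zero] at h
  refine h.trans (le_of_eq ?_)
  congr 1
  field_simp
  ring

lemma sum_postVar_mul_log_le (hk : (Matrix.of k).PosSemidef) (hv : 0 < v)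
    (hk1 : ∀ z, k z z ≤ 1) (z : ℕ → ι) (N : ℕ) :
    (∑ t ∈ Finset.range N, postVar k v (fun i : Fin t => z i) (z t)) * Real.log (1 + (v : ℝ)⁻¹) ≤
      Real.log (noisyGram k v (fun i : Fin N => z i)).det - N * Real.log v := by
  rw [log_det_noisyGram_eq_sum hk hv, Finset.sum_mul]
  exact Finset.sum_le_sum fun t _ => mul_log_le_log_one_add_div (NNReal.coe_pos.2 hv)
    (postVar_nonneg hk hv _ _) ((postVar_le hk hv _ _).trans (hk1 _))

end Posterior

/-! ### The mutual information of a Gaussian process and its noisy observations -/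

section InformationFormula

/-- A product of measures with integrable densities has the product density. -/
lemma pi_withDensity_ofReal {J : Type*} [Fintype J] {μ : J → Measure ℝ} [∀ i, SigmaFinite (μ i)]
    {d : J → ℝ → ℝ} (hd : ∀ i, Integrable (d i) (μ i)) (hd0 : ∀ i x, 0 ≤ d i x) :
    Measure.pi (fun i => (μ i).withDensity fun x => ENNReal.ofReal (d i x)) =
      (Measure.pi μ).withDensity fun x => ENNReal.ofReal (∏ i, d i (x i)) := by
  have : ∀ i, SigmaFinite ((μ i).withDensity fun x => ENNReal.ofReal (d i x)) := fun i =>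
    SigmaFinite.withDensity_ofReal _
  refine (Measure.pi_eq fun s hs => ?_)
  rw [withDensity_apply _ (MeasurableSet.univ_pi hs), Measure.restrict_pi_pi,
    ← ofReal_integral_eq_lintegral_ofReal
      (Integrable.fintype_prod fun i => (hd i).restrict)
      (ae_of_all _ fun x => Finset.prod_nonneg fun i _ => hd0 i _),
    integral_fintype_prod_eq_prod, ENNReal.ofReal_prod_of_nonneg
      (fun i _ => integral_nonneg (hd0 i))]
  refine Finset.prod_congr rfl fun i _ => ?_
  rw [withDensity_apply _ (hs i), ofReal_integral_eq_lintegral_ofReal (hd i).restrict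
    (ae_of_all _ (hd0 i))]

/-- The law of `T` independent `N(0, v)` noises. -/
def noiseLaw (v : ℝ≥0) (T : ℕ) : Measure (Fin T → ℝ) :=
  Measure.pi fun _ => gaussianReal 0 v

instance (v : ℝ≥0) (T : ℕ) : IsProbabilityMeasure (noiseLaw v T) := by
  unfold noiseLaw; infer_instance

/-- The Lebesgue density of `noiseLaw v T`. -/
def noiseDensity (v : ℝ≥0) {T : ℕ} (y : Fin T → ℝ) : ℝ := ∏ i, gaussianPDFReal 0 v (y i)

variable {v : ℝ≥0} {T : ℕ}

lemma noiseDensity_pos (hv : 0 < v) (y : Fin T → ℝ) : 0 < noiseDensity v y :=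
  Finset.prod_pos fun _ _ => gaussianPDFReal_pos _ _ _ hv.ne'

@[fun_prop]
lemma measurable_noiseDensity : Measurable (noiseDensity v (T := T)) :=
  Finset.measurable_prod _ fun i _ =>
    (measurable_gaussianPDFReal 0 v).comp (measurable_pi_apply i)

lemma log_noiseDensity (hv : 0 < v) (y : Fin T → ℝ) :
    Real.log (noiseDensity v y) =
      T * Real.log (√(2 * Real.pi * v))⁻¹ - (∑ i, y i ^ 2) / (2 * v) := by
  have hv' : (0 : ℝ) < v := NNReal.coe_pos.2 hv
  rw [noiseDensity, Real.log_prod fun i _ => (gaussianPDFReal_pos _ _ _ hv.ne').ne']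
  have : ∀ i, Real.log (gaussianPDFReal 0 v (y i)) =
      Real.log (√(2 * Real.pi * v))⁻¹ - y i ^ 2 / (2 * v) := by
    intro i
    rw [gaussianPDFReal, Real.log_mul (by positivity) (Real.exp_ne_zero _), Real.log_exp]
    simp [sub_eq_add_neg, neg_div]
  simp_rw [this]
  rw [Finset.sum_sub_distrib, ← Finset.sum_div]
  simp

lemma noiseLaw_eq_withDensity (hv : 0 < v) :
    noiseLaw v T = volume.withDensity fun y => ENNReal.ofReal (noiseDensity v y) := by
  rw [noiseLaw]
  simp_rw [gaussianReal_of_var_ne_zero 0 hv.ne']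
  exact pi_withDensity_ofReal (fun _ => integrable_gaussianPDFReal 0 v)
    (fun _ _ => gaussianPDFReal_nonneg _ _ _)

lemma charFun_noiseLaw (t : EuclideanSpace ℝ (Fin T)) :
    charFun ((noiseLaw v T).map (WithLp.toLp 2)) t =
      Complex.exp (-((v * (t.ofLp ⬝ᵥ t.ofLp) : ℝ) / 2 : ℂ)) := by
  rw [noiseLaw, charFun_pi]
  simp_rw [charFun_gaussianReal]
  rw [← Complex.exp_sum]
  congr 1
  simp only [dotProduct]
  push_cast
  rw [Finset.mul_sum, Finset.sum_div, ← Finset.sum_neg_distrib]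
  refine Finset.sum_congr rfl fun i _ => ?_
  ring_nf

lemma integrable_sum_sq_noiseLaw : Integrable (fun e => ∑ i, e i ^ 2) (noiseLaw v T) := by
  refine integrable_finsetSum _ fun i _ => ?_
  exact integrable_comp_eval (μ := fun _ : Fin T => gaussianReal 0 v) (i := i)
    (f := fun x : ℝ => x ^ 2) (memLp_id_gaussianReal 2).integrable_sq

/-- The density of an invertible linear image of the noise. -/
lemma map_mulVec_noiseLaw (hv : 0 < v) (B : Matrix (Fin T) (Fin T) ℝ) (hB : B.det ≠ 0) :
    (noiseLaw v T).map (fun e => B *ᵥ e) =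
      volume.withDensity fun y => ENNReal.ofReal (|B.det|⁻¹ * noiseDensity v (B⁻¹ *ᵥ y)) := by
  have hBm : Measurable (fun e : Fin T → ℝ => B *ᵥ e) := by fun_prop
  have hBm' : Measurable (fun e : Fin T → ℝ => B⁻¹ *ᵥ e) := by fun_prop
  refine Measure.ext_of_lintegral _ fun F hF => ?_
  rw [lintegral_map hF hBm, noiseLaw_eq_withDensity hv,
    lintegral_withDensity_eq_lintegral_mul _ (by fun_prop) (by fun_prop),
    lintegral_withDensity_eq_lintegral_mul _ (by fun_prop) hF]
  have h1 := Real.map_matrix_volume_pi_eq_smul_volume_pi hB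
  have h2 : ∀ G : (Fin T → ℝ) → ℝ≥0∞, Measurable G →
      ∫⁻ e, G (B *ᵥ e) = ENNReal.ofReal |B.det|⁻¹ * ∫⁻ y, G y := by
    intro G hG
    rw [← smul_eq_mul, ← lintegral_smul_measure, ← abs_inv, ← h1, lintegral_map hG]
    · rfl
    · exact hBm
  have h3 := h2 (fun y => ENNReal.ofReal (noiseDensity v (B⁻¹ *ᵥ y)) * F y) (by fun_prop)
  rw [← lintegral_const_mul _ (by fun_prop)] at h3
  refine Eq.trans (lintegral_congr fun e => ?_) (h3.trans (lintegral_congr fun y => ?_))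
  · simp [Matrix.mulVec_mulVec, Matrix.nonsing_inv_mul _ (isUnit_iff_ne_zero.2 hB)]
  · rw [Pi.mul_apply, ENNReal.ofReal_mul (by positivity), mul_assoc]

variable {ι : Type*} [Fintype ι] [DecidableEq ι] {k : ι → ι → ℝ}

lemma observationLaw_snd (a : Fin T → ι) :
    (observationLaw k v a).snd = multivariateGaussian 0 (Matrix.of k) := by
  rw [observationLaw, Measure.snd, Measure.map_map (by fun_prop) (by fun_prop)]
  exact Measure.fst_prod (μ := multivariateGaussian 0 (Matrix.of k)) (ν := noiseLaw v T)

lemma observationLaw_fst (a : Fin T → ι) :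
    (observationLaw k v a).fst = ((multivariateGaussian 0 (Matrix.of k)).prod
      (noiseLaw v T)).map fun q => fun i => q.1 (a i) + q.2 i := by
  rw [observationLaw, Measure.fst, Measure.map_map (by fun_prop) (by fun_prop)]
  rfl

instance (a : Fin T → ι) : IsProbabilityMeasure (observationLaw k v a) :=
  Measure.isProbabilityMeasure_map (by fun_prop)

/-- The joint law of observations and latent values has the noise density at the residual. -/
lemma observationLaw_eq_withDensity (hv : 0 < v) (a : Fin T → ι) :
    observationLaw k v a =
      ((volume : Measure (Fin T → ℝ)).prod (multivariateGaussian 0 (Matrix.of k))).withDensity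
        fun p => ENNReal.ofReal (noiseDensity v (p.1 - fun i => p.2 (a i))) := by
  refine Measure.ext_of_lintegral _ fun F hF => ?_
  have hd : Measurable fun p : (Fin T → ℝ) × EuclideanSpace ℝ ι =>
      ENNReal.ofReal (noiseDensity v (p.1 - fun i => p.2 (a i))) := by fun_prop
  rw [observationLaw, lintegral_map hF (by fun_prop),
    lintegral_prod _ (by fun_prop),
    lintegral_withDensity_eq_lintegral_mul _ hd hF,
    lintegral_prod_symm _ (by fun_prop)]
  refine lintegral_congr fun f => ?_
  change ∫⁻ e, F (fun i => f (a i) + e i, f) ∂(noiseLaw v T) = _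
  rw [noiseLaw_eq_withDensity hv,
    lintegral_withDensity_eq_lintegral_mul _ (by fun_prop) (by fun_prop),
    ← lintegral_add_left_eq_self (μ := volume) (fun y : Fin T → ℝ =>
      ((fun p : (Fin T → ℝ) × EuclideanSpace ℝ ι =>
        ENNReal.ofReal (noiseDensity v (p.1 - fun i => p.2 (a i)))) * F) (y, f))
      (fun i => f (a i))]
  refine lintegral_congr fun e => ?_
  simp only [Pi.mul_apply, add_sub_cancel_left]
  rfl

/-- The observations are a linear image of the noise, for every square root of the normalized
covariance matrix. -/
lemma observationLaw_fst_eq_map (hk : (Matrix.of k).PosSemidef) (a : Fin T → ι)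
    (B : Matrix (Fin T) (Fin T) ℝ) (hB : (v : ℝ) • (B * Bᵀ) = noisyGram k v a) :
    (observationLaw k v a).fst = (noiseLaw v T).map (fun e => B *ᵥ e) := by
  refine (MeasurableEquiv.toLp 2 (Fin T → ℝ)).map_measurableEquiv_injective ?_
  have hBm : Measurable (fun e : Fin T → ℝ => B *ᵥ e) := by fun_prop
  have : IsProbabilityMeasure ((noiseLaw v T).map (fun e => B *ᵥ e)) :=
    Measure.isProbabilityMeasure_map hBm.aemeasurable
  refine Measure.ext_of_charFun (funext fun t => ?_)
  rw [observationLaw_fst, MeasurableEquiv.coe_toLp,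
    Measure.map_map (by fun_prop) (by fun_prop), Measure.map_map (by fun_prop) hBm]
  -- the matrix of the evaluation at the points `a`
  set P : Matrix (Fin T) ι ℝ := Matrix.of fun i z => if a i = z then 1 else 0 with hP
  have hPf : ∀ f : ι → ℝ, P *ᵥ f = fun i => f (a i) := by
    intro f
    ext i
    simp [hP, Matrix.mulVec, dotProduct]
  have hright : charFun ((noiseLaw v T).map (WithLp.toLp 2 ∘ fun e => B *ᵥ e)) t =
      charFun ((noiseLaw v T).map (WithLp.toLp 2)) (WithLp.toLp 2 (Bᵀ *ᵥ t.ofLp)) := by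
    rw [charFun_apply, charFun_apply, integral_map (by fun_prop) (by fun_prop),
      integral_map (by fun_prop) (by fun_prop)]
    refine integral_congr_ae (ae_of_all _ fun e => ?_)
    simp only [Function.comp, EuclideanSpace.inner_eq_star_dotProduct, star_trivial]
    rw [Matrix.mulVec_transpose, ← Matrix.dotProduct_mulVec]
  have hleft : charFun (((multivariateGaussian 0 (Matrix.of k)).prod (noiseLaw v T)).map
      (WithLp.toLp 2 ∘ fun q => fun i => q.1 (a i) + q.2 i)) t =
      charFun (multivariateGaussian 0 (Matrix.of k)) (WithLp.toLp 2 (Pᵀ *ᵥ t.ofLp)) *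
        charFun ((noiseLaw v T).map (WithLp.toLp 2)) t := by
    rw [charFun_apply, charFun_apply, charFun_apply, integral_map (by fun_prop) (by fun_prop),
      integral_map (by fun_prop) (by fun_prop), ← integral_prod_mul]
    refine integral_congr_ae (ae_of_all _ fun q => ?_)
    simp only [Function.comp, EuclideanSpace.inner_eq_star_dotProduct, star_trivial]
    rw [← Complex.exp_add, ← add_mul, ← Complex.ofReal_add]
    congr 3
    rw [Matrix.mulVec_transpose, ← Matrix.dotProduct_mulVec, hPf, ← dotProduct_add]
    rfl
  rw [hleft, hright, charFun_noiseLaw, charFun_noiseLaw, charFun_multivariateGaussian hk,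
    ← Complex.exp_add]
  have hcov : (Pᵀ *ᵥ t.ofLp) ⬝ᵥ (Matrix.of k *ᵥ (Pᵀ *ᵥ t.ofLp)) + v * (t.ofLp ⬝ᵥ t.ofLp) =
      v * ((Bᵀ *ᵥ t.ofLp) ⬝ᵥ (Bᵀ *ᵥ t.ofLp)) := by
    have hM : P * Matrix.of k * Pᵀ + (v : ℝ) • 1 = (v : ℝ) • (B * Bᵀ) := by
      rw [hB, noisyGram]
      congr 1
      ext i j
      simp [hP, Matrix.mul_apply]
    have hq : ∀ (n : Type _) [Fintype n] (C : Matrix (Fin T) n ℝ) (y : n → ℝ),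
        (Cᵀ *ᵥ t.ofLp) ⬝ᵥ y = t.ofLp ⬝ᵥ (C *ᵥ y) := by
      intro n _ C y
      rw [Matrix.mulVec_transpose, ← Matrix.dotProduct_mulVec]
    rw [hq, Matrix.mulVec_transpose B, ← Matrix.dotProduct_mulVec, ← Matrix.mulVec_transpose B,
      Matrix.mulVec_mulVec, Matrix.mulVec_mulVec, Matrix.mulVec_mulVec]
    have := congrArg (fun M => t.ofLp ⬝ᵥ (M *ᵥ t.ofLp)) hM
    simpa [Matrix.add_mulVec, Matrix.smul_mulVec, Matrix.mul_assoc] using this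
  rw [← hcov]
  congr 1
  simp
  ring

/-- The density of the joint law with respect to the product of its marginals: the noise density
at the residual over that of the observations, which are `B` times a noise vector. -/
lemma observationLaw_eq_withDensity_prod (hk : (Matrix.of k).PosSemidef) (hv : 0 < v)
    (a : Fin T → ι) (B : Matrix (Fin T) (Fin T) ℝ) (hB : (v : ℝ) • (B * Bᵀ) = noisyGram k v a)
    (hdet : B.det ≠ 0) :
    observationLaw k v a =
      ((observationLaw k v a).fst.prod (observationLaw k v a).snd).withDensity fun p =>
        ENNReal.ofReal (noiseDensity v (p.1 - fun i => p.2 (a i)) /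
          (|B.det|⁻¹ * noiseDensity v (B⁻¹ *ᵥ p.1))) := by
  have hBm' : Measurable (fun e : Fin T → ℝ => B⁻¹ *ᵥ e) := by fun_prop
  conv_lhs => rw [observationLaw_eq_withDensity hv]
  rw [observationLaw_snd, observationLaw_fst_eq_map hk a B hB, map_mulVec_noiseLaw hv B hdet,
    prod_withDensity_left (by fun_prop), ← withDensity_mul _ (by fun_prop) (by fun_prop)]
  congr 1
  ext p
  have h1 := noiseDensity_pos hv (B⁻¹ *ᵥ p.1)
  have h2 := abs_pos.2 hdet
  rw [Pi.mul_apply, ← ENNReal.ofReal_mul (by positivity), mul_div_cancel₀ _ (by positivity)]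

open scoped MatrixOrder in
/-- The mutual information between the observations and the Gaussian process is half the
log-determinant of the normalized noisy Gram matrix. -/
theorem toReal_mutualInformation_observationLaw (hk : (Matrix.of k).PosSemidef) (hv : 0 < v)
    (a : Fin T → ι) :
    (mutualInformation (observationLaw k v a)).toReal =
      (Real.log (noisyGram k v a).det - T * Real.log v) / 2 := by
  have hv' : (0 : ℝ) < v := NNReal.coe_pos.2 hv
  have hM : ((v : ℝ)⁻¹ • noisyGram k v a).PosDef :=
    (posDef_noisyGram hk hv a).smul (inv_pos.2 hv')
  set B := CFC.sqrt ((v : ℝ)⁻¹ • noisyGram k v a) with hBdef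
  have hBB : B * B = (v : ℝ)⁻¹ • noisyGram k v a :=
    CFC.sqrt_mul_sqrt_self _ hM.posSemidef.nonneg
  have hBT : Bᵀ = B := by
    have := (Matrix.nonneg_iff_posSemidef.1
      (CFC.sqrt_nonneg ((v : ℝ)⁻¹ • noisyGram k v a))).isHermitian.eq
    rwa [Matrix.conjTranspose_eq_transpose_of_trivial] at this
  have hB : (v : ℝ) • (B * Bᵀ) = noisyGram k v a := by
    rw [hBT, hBB, smul_inv_smul₀ hv'.ne']
  have hdet2 : B.det * B.det = ((v : ℝ)⁻¹) ^ T * (noisyGram k v a).det := by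
    rw [← Matrix.det_mul, hBB, Matrix.det_smul, Fintype.card_fin]
  have hGpos := (posDef_noisyGram hk hv a).det_pos
  have hdet : B.det ≠ 0 := by
    intro h
    rw [h, mul_zero] at hdet2
    have : 0 < ((v : ℝ)⁻¹) ^ T * (noisyGram k v a).det := by positivity
    linarith
  have hlogdet : Real.log |B.det| = (Real.log (noisyGram k v a).det - T * Real.log v) / 2 := by
    have := congrArg Real.log hdet2
    rw [Real.log_mul hdet hdet, Real.log_mul (by positivity) hGpos.ne', Real.log_pow,
      Real.log_inv] at this
    rw [Real.log_abs]
    linarith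
  have hBm : Measurable (fun e : Fin T → ℝ => B *ᵥ e) := by fun_prop
  have hBm' : Measurable (fun e : Fin T → ℝ => B⁻¹ *ᵥ e) := by fun_prop
  have hdens := observationLaw_eq_withDensity_prod hk hv a B hB hdet
  set ρ := observationLaw k v a with hρ
  have hac : ρ ≪ ρ.fst.prod ρ.snd := by
    rw [hdens]
    convert withDensity_absolutelyContinuous _ _ using 1
    rw [← hdens]
  have hllr : llr ρ (ρ.fst.prod ρ.snd) =ᵐ[ρ] fun p => (∑ i, (B⁻¹ *ᵥ p.1) i ^ 2) / (2 * v) -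
      (∑ i, (p.1 - fun i => p.2 (a i)) i ^ 2) / (2 * v) + Real.log |B.det| := by
    have h1 := Measure.rnDeriv_withDensity (ρ.fst.prod ρ.snd) (f := fun p =>
        ENNReal.ofReal (noiseDensity v (p.1 - fun i => p.2 (a i)) /
          (|B.det|⁻¹ * noiseDensity v (B⁻¹ *ᵥ p.1)))) (by fun_prop)
    rw [← hdens] at h1
    filter_upwards [hac.ae_le h1] with p hp
    have h2 := noiseDensity_pos hv (B⁻¹ *ᵥ p.1)
    have h3 := abs_pos.2 hdet
    have h4 := noiseDensity_pos hv (p.1 - fun i => p.2 (a i))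
    rw [llr, hp, ENNReal.toReal_ofReal (by positivity), Real.log_div h4.ne' (by positivity),
      Real.log_mul (by positivity) h2.ne', Real.log_inv, log_noiseDensity hv, log_noiseDensity hv]
    ring
  -- The residual and the whitened observations have the same law, so the quadratic terms cancel in
  -- expectation, and only `log |det B|` is left.
  have hres : ρ.map (fun p => p.1 - fun i => p.2 (a i)) = noiseLaw v T := by
    rw [hρ, observationLaw, Measure.map_map (by fun_prop) (by fun_prop)]
    convert Measure.snd_prod (μ := multivariateGaussian 0 (Matrix.of k)) (ν := noiseLaw v T)
      using 1
    rw [Measure.snd]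
    congr 1
    ext q i
    simp
  have hwhite : ρ.map (fun p => B⁻¹ *ᵥ p.1) = noiseLaw v T := by
    have h1 : ρ.map (fun p => B⁻¹ *ᵥ p.1) = ρ.fst.map (fun y => B⁻¹ *ᵥ y) := by
      rw [Measure.fst, Measure.map_map hBm' measurable_fst]
      rfl
    rw [h1, observationLaw_fst_eq_map hk a B hB, Measure.map_map hBm' hBm]
    convert Measure.map_id using 2
    ext e
    simp [Matrix.mulVec_mulVec, Matrix.nonsing_inv_mul _ (isUnit_iff_ne_zero.2 hdet)]
  have hsq : Measurable fun e : Fin T → ℝ => ∑ i, e i ^ 2 := by fun_prop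
  have key : ∀ φ : (Fin T → ℝ) × EuclideanSpace ℝ ι → Fin T → ℝ, Measurable φ →
      ρ.map φ = noiseLaw v T → Integrable (fun p => (∑ i, φ p i ^ 2) / (2 * (v : ℝ))) ρ ∧
        ∫ p, (∑ i, φ p i ^ 2) / (2 * (v : ℝ)) ∂ρ =
          (∫ e, ∑ i, e i ^ 2 ∂(noiseLaw v T)) / (2 * v) := by
    intro φ hφ hm
    refine ⟨?_, ?_⟩
    · refine Integrable.div_const ?_ _
      have h := integrable_sum_sq_noiseLaw (v := v) (T := T)
      rw [← hm] at h
      exact h.comp_measurable hφ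
    · rw [integral_div, ← hm, integral_map hφ.aemeasurable hsq.aestronglyMeasurable]
  obtain ⟨i1, e1⟩ := key (fun p => B⁻¹ *ᵥ p.1) (by fun_prop) hwhite
  obtain ⟨i2, e2⟩ := key (fun p => p.1 - fun i => p.2 (a i)) (by fun_prop) hres
  have i3 : Integrable (fun p : (Fin T → ℝ) × EuclideanSpace ℝ ι =>
      (∑ i, (B⁻¹ *ᵥ p.1) i ^ 2) / (2 * (v : ℝ)) -
      (∑ i, (p.1 - fun i => p.2 (a i)) i ^ 2) / (2 * (v : ℝ))) ρ := i1.sub i2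
  rw [mutualInformation, InformationTheory.toReal_klDiv_of_measure_eq hac (by simp),
    integral_congr_ae hllr, integral_add i3 (integrable_const _), integral_sub i1 i2,
    e1, e2, ← hlogdet]
  simp

end InformationFormula

/-! ### The maximum information gain -/

section MaxInfoGain

variable {ι : Type*} [Fintype ι] [DecidableEq ι] {k : ι → ι → ℝ} {v : ℝ≥0}

lemma mutualInformation_le_maxInfoGain {T : ℕ} (a : Fin T → ι) :
    (mutualInformation (observationLaw k v a)).toReal ≤ maxInfoGain k v T :=
  le_ciSup (f := fun a : Fin T → ι => (mutualInformation (observationLaw k v a)).toReal)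
    (Set.finite_range _).bddAbove a

/-- Subadditivity of the maximum information gain in the number of observations. -/
lemma maxInfoGain_add_le [Nonempty ι] (hk : (Matrix.of k).PosSemidef) (hv : 0 < v) (m n : ℕ) :
    maxInfoGain k v (m + n) ≤ maxInfoGain k v m + maxInfoGain k v n := by
  refine ciSup_le fun c => ?_
  set a : Fin m → ι := fun i => c (Fin.castAdd n i)
  set b : Fin n → ι := fun i => c (Fin.natAdd m i)
  have hc : c = Fin.append a b := by
    ext i
    refine Fin.addCases (fun j => ?_) (fun j => ?_) i <;> simp [a, b]
  refine le_trans ?_ (add_le_add (mutualInformation_le_maxInfoGain a)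
    (mutualInformation_le_maxInfoGain b))
  have hpos := fun (t : ℕ) (z : Fin t → ι) => (posDef_noisyGram hk hv z).det_pos
  have h := Real.log_le_log (hpos _ (Fin.append a b)) (det_noisyGram_append_le hk hv a b)
  rw [Real.log_mul (hpos _ a).ne' (hpos _ b).ne'] at h
  rw [hc, toReal_mutualInformation_observationLaw hk hv,
    toReal_mutualInformation_observationLaw hk hv, toReal_mutualInformation_observationLaw hk hv]
  push_cast
  linarith

lemma maxInfoGain_mul_le [Nonempty ι] (hk : (Matrix.of k).PosSemidef) (hv : 0 < v) (n T : ℕ) :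
    maxInfoGain k v (n * T) ≤ n * maxInfoGain k v T := by
  induction n with
  | zero =>
    rw [zero_mul]
    refine ciSup_le fun c => ?_
    rw [toReal_mutualInformation_observationLaw hk hv]
    simp
  | succ n ih =>
    rw [add_mul, one_mul]
    refine (maxInfoGain_add_le hk hv _ _).trans ?_
    push_cast
    linarith

/-- The posterior variances met along a sequence of points are controlled by the information
gain. -/
lemma sum_postVar_le [Nonempty ι] (hk : (Matrix.of k).PosSemidef) (hv : 0 < v)
    (hk1 : ∀ z, k z z ≤ 1) (z : ℕ → ι) (T : ℕ) :
    ∑ t ∈ Finset.range (T ^ 2), postVar k v (fun i : Fin t => z i) (z t) ≤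
      2 / Real.log (1 + (v : ℝ)⁻¹) * (T * maxInfoGain k v T) := by
  have hv' : (0 : ℝ) < v := NNReal.coe_pos.2 hv
  have hlog : 0 < Real.log (1 + (v : ℝ)⁻¹) :=
    Real.log_pos (by have : 0 < (v : ℝ)⁻¹ := by positivity
                     linarith)
  have h1 := sum_postVar_mul_log_le hk hv hk1 z (T ^ 2)
  have h2 := mutualInformation_le_maxInfoGain (k := k) (v := v) (fun i : Fin (T ^ 2) => z i)
  rw [toReal_mutualInformation_observationLaw hk hv] at h2
  have h3 := maxInfoGain_mul_le hk hv T T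
  rw [← sq] at h3
  rw [div_mul_eq_mul_div, le_div_iff₀ hlog]
  linarith

end MaxInfoGain

/-! ### Worst-case expectations -/

section WorstCase

variable {Om : Type*} [Fintype Om] {A : Set (Om → ℝ)}

lemma bddBelow_worstCase (hA : A ⊆ stdSimplex ℝ Om) (v : Om → ℝ) :
    BddBelow ((fun p : Om → ℝ => ∑ w, v w * p w) '' A) := by
  have : BddBelow ((fun p : Om → ℝ => ∑ w, v w * p w) '' stdSimplex ℝ Om) :=
    ((isCompact_stdSimplex ℝ Om).image (by fun_prop)).bddBelow
  exact this.mono (Set.image_mono hA)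

lemma worstCase_le_add (hA : A ⊆ stdSimplex ℝ Om) (hne : A.Nonempty) {v v' : Om → ℝ} {D : ℝ}
    (h : ∀ w, v w ≤ v' w + D) : worstCase A v ≤ worstCase A v' + D := by
  rw [← sub_le_iff_le_add]
  refine le_csInf (hne.image _) ?_
  rintro _ ⟨p, hp, rfl⟩
  rw [sub_le_iff_le_add]
  refine (csInf_le (bddBelow_worstCase hA v) ⟨p, hp, rfl⟩).trans ?_
  obtain ⟨hp0, hp1⟩ := hA hp
  calc ∑ w, v w * p w ≤ ∑ w, (v' w + D) * p w :=
        Finset.sum_le_sum fun w _ => mul_le_mul_of_nonneg_right (h w) (hp0 w)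
    _ = ∑ w, v' w * p w + D := by
        simp_rw [add_mul]
        rw [Finset.sum_add_distrib, ← Finset.mul_sum, hp1, mul_one]

lemma worstCase_zero (hne : A.Nonempty) : worstCase A (fun _ => 0) = 0 := by
  simp [worstCase, hne.image_const]

lemma worstCase_nonneg (hA : A ⊆ stdSimplex ℝ Om) (hne : A.Nonempty) {v : Om → ℝ}
    (h : ∀ w, 0 ≤ v w) : 0 ≤ worstCase A v := by
  have := worstCase_le_add hA hne (v := fun _ => 0) (v' := v) (D := 0) (by simpa using h)
  rwa [worstCase_zero hne, add_zero] at this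

lemma worstCase_le_one (hA : A ⊆ stdSimplex ℝ Om) (hne : A.Nonempty) {v : Om → ℝ}
    (h : ∀ w, v w ≤ 1) : worstCase A v ≤ 1 := by
  have := worstCase_le_add hA hne (v := v) (v' := fun _ => 0) (D := 1) (by simpa using h)
  rwa [worstCase_zero hne, zero_add] at this

end WorstCase

/-! ### The parameters of the algorithm -/

section Parameters

variable {X Om : Type*} [Fintype X] [Fintype Om] [Nonempty X] [Nonempty Om] {c : Params X Om}

lemma one_le_beta_arg (hdelta : c.delta ∈ Set.Ioo (0 : ℝ) 1) {t : ℕ} (ht : 1 ≤ t) :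
    1 ≤ 2 * (Fintype.card (X × Om) : ℝ) * Real.pi ^ 2 * (t : ℝ) ^ 2 / (3 * c.delta) := by
  obtain ⟨h0, h1⟩ := hdelta
  rw [one_le_div (by linarith)]
  have h2 : (1 : ℝ) ≤ Fintype.card (X × Om) := by exact_mod_cast Fintype.card_pos
  have h3 : (1 : ℝ) ≤ (t : ℝ) ^ 2 := one_le_pow₀ (by exact_mod_cast ht)
  have h4 : (9 : ℝ) ≤ Real.pi ^ 2 := by nlinarith [Real.pi_gt_three]
  calc 3 * c.delta ≤ 2 * 1 * 9 * 1 := by linarith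
    _ ≤ _ := by gcongr

lemma beta_nonneg (hdelta : c.delta ∈ Set.Ioo (0 : ℝ) 1) {t : ℕ} (ht : 1 ≤ t) :
    0 ≤ beta c t :=
  mul_nonneg zero_le_two (Real.log_nonneg (one_le_beta_arg hdelta ht))

lemma beta_mono (hdelta : c.delta ∈ Set.Ioo (0 : ℝ) 1) {s t : ℕ} (hs : 1 ≤ s) (hst : s ≤ t) :
    beta c s ≤ beta c t := by
  have h0 := hdelta.1
  unfold beta
  refine mul_le_mul_of_nonneg_left (Real.log_le_log
    (zero_lt_one.trans_le (one_le_beta_arg hdelta hs)) ?_) zero_le_two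
  gcongr

lemma eta_nonneg (hxi : 0 < c.xi) (hdelta : c.delta ∈ Set.Ioo (0 : ℝ) 1) : 0 ≤ eta c := by
  have := hdelta.1
  unfold eta
  positivity

lemma eta_le (hxi : 0 < c.xi) (hkg : ∀ z, c.kg z z ≤ 1) :
    eta c ≤ c.xi / 2 := by
  refine (min_le_left _ _).trans ?_
  have h1 : sigmaGMinSq c ≤ 1 :=
    (ciInf_le (Set.finite_range _).bddBelow (Classical.arbitrary (X × Om))).trans (hkg _)
  have h2 : √(sigmaGMinSq c) ≤ 1 := Real.sqrt_le_one.2 h1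
  nlinarith

end Parameters

/-! ### Width of the credible intervals at a selected point -/

section Step

variable {X Om : Type*} [Fintype Om] {c : Params X Om} {t : ℕ} {pstar : Om → ℝ}

lemma candidates_subset : candidates c t pstar ⊆ stdSimplex ℝ Om := fun _ hp => hp.1

lemma candidates_nonempty (hdist : ∀ p ∈ stdSimplex ℝ Om, c.dist p p = 0)
    (heps : ∀ t, 0 < c.eps t) (hp : pstar ∈ stdSimplex ℝ Om) :
    (candidates c t pstar).Nonempty :=
  ⟨pstar, hp, by rw [hdist _ hp]; exact (heps t).le⟩

variable [Fintype X] {D : Data X Om t}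

/-- A credible interval of half-width `√b √s` and length at least `r` forces `b s ≥ r² / 4`. -/
lemma le_beta_mul_of_le_width {b s r : ℝ} (hb : 0 ≤ b) (hs : 0 ≤ s) (hr : 0 ≤ r)
    (h : r ≤ 2 * (√b * √s)) : r ^ 2 / 4 ≤ b * s := by
  rw [← Real.sqrt_mul hb] at h
  have h1 := Real.sq_sqrt (mul_nonneg hb hs)
  have h2 := pow_le_pow_left₀ hr h 2
  nlinarith

/-- At a point of `M_t` the credible interval of `g` crosses `(h - η, h]` for some `w`. -/
lemma exists_eta_le_width_of_mem_setM {x : X} (hxi : 0 < c.xi)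
    (hx : x ∈ setM c D pstar) :
    ∃ w, eta c ≤ 2 * (√(beta c t) * √(postVar c.kg c.varg D.pt (x, w))) := by
  obtain ⟨h1, h2⟩ := hx
  by_contra! hcon
  have heq : uInd c D x = lInd c D x := by
    funext w
    unfold uInd lInd
    have := hcon w
    split_ifs with h3 h4
    · rfl
    · exfalso
      unfold lg at h3
      unfold ug at h4
      linarith
    · rfl
  unfold uG at h2
  unfold lG at h1
  rw [heq] at h2
  linarith

lemma acqG_eq_one_of_mem_setH {x : X} (hx : x ∈ setH c D pstar) : acqG c D pstar x = 1 := by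
  simp [acqG, hx]

/-- The feasibility factor of the acquisition function is at least `min 1 ξ` outside `L_t`. -/
lemma min_one_xi_le_acqG {x : X} (hA : (candidates c t pstar).Nonempty) (hxi : 0 < c.xi)
    (hx : x ∈ setH c D pstar ∪ setM c D pstar) : min 1 c.xi ≤ acqG c D pstar x := by
  rcases hx with hx | hx
  · rw [acqG_eq_one_of_mem_setH hx]
    exact min_le_left _ _
  · have hxH : x ∉ setH c D pstar := fun h => not_lt.2 hx.1 h
    simp only [acqG, hxH, hx, if_true, if_false]
    refine (min_le_right _ _).trans ?_
    have hl : 0 ≤ lG c D pstar x := worstCase_nonneg candidates_subset hA fun w => by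
      unfold lInd; split_ifs <;> norm_num
    have hu : uG c D pstar x ≤ 1 := worstCase_le_one candidates_subset hA fun w => by
      unfold uInd; split_ifs <;> norm_num
    obtain ⟨h1, h2⟩ := hx
    rw [le_div_iff₀ (by linarith)]
    nlinarith

/-- At a point of `H_t` that maximizes the acquisition function while the stopping condition (S2)
fails, the worst-case credible interval of `f` is wide. -/
lemma le_uF_sub_lF_of_mem_setH {x : X} (hA : (candidates c t pstar).Nonempty) (hxi : 0 < c.xi)
    (hx : x ∈ setH c D pstar)
    (hmax : IsMaxOn (acq c D pstar) (setH c D pstar ∪ setM c D pstar) x)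
    (hS2 : ¬ stopS2 c D pstar) :
    c.xi * min 1 c.xi ≤ uF c D pstar x - lF c D pstar x := by
  have hH : (setH c D pstar).Nonempty := ⟨x, hx⟩
  have hgap : c.xi ≤ sSup (uF c D pstar '' (setH c D pstar ∪ setM c D pstar)) -
      sSup (lF c D pstar '' setH c D pstar) := by
    by_contra! h
    exact hS2 ⟨hH, h⟩
  have hc : cBest c D pstar = sSup (lF c D pstar '' setH c D pstar) := by simp [cBest, hH]
  obtain ⟨x', hx', hx'e⟩ : sSup (uF c D pstar '' (setH c D pstar ∪ setM c D pstar)) ∈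
      uF c D pstar '' (setH c D pstar ∪ setM c D pstar) :=
    Set.Nonempty.csSup_mem ((hH.mono Set.subset_union_left).image _) (Set.toFinite _)
  have hcx : lF c D pstar x ≤ cBest c D pstar := by
    rw [hc]
    exact le_csSup (Set.toFinite _).bddAbove ⟨x, hx, rfl⟩
  have h1 : c.xi ≤ acqF c D pstar x' := by
    refine le_trans ?_ (le_max_left _ _)
    rw [hx'e, hc]
    exact hgap
  have hm0 : 0 < min 1 c.xi := lt_min one_pos hxi
  have h2 : c.xi * min 1 c.xi ≤ acq c D pstar x' :=
    mul_le_mul h1 (min_one_xi_le_acqG hA hxi hx') hm0.le (hxi.le.trans h1)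
  have h3 : acq c D pstar x' ≤ acq c D pstar x := hmax hx'
  have h4 : acq c D pstar x = max (uF c D pstar x - cBest c D pstar) 0 := by
    rw [acq, acqG_eq_one_of_mem_setH hx, mul_one, acqF]
  have h5 : 0 < c.xi * min 1 c.xi := mul_pos hxi hm0
  rcases le_max_iff.1 ((h2.trans h3).trans h4.le) with h | h
  · linarith
  · linarith

/-- The widest credible interval of `f` at `x` bounds the width of the worst-case interval. -/
lemma exists_le_width_of_le_uF_sub_lF [Nonempty Om] {x : X} {r : ℝ}
    (hA : (candidates c t pstar).Nonempty)
    (h : r ≤ uF c D pstar x - lF c D pstar x) :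
    ∃ w, r ≤ 2 * (√(beta c t) * √(postVar c.kf c.varf D.pt (x, w))) := by
  obtain ⟨w, hw⟩ := Finite.exists_max
    fun w => 2 * (√(beta c t) * √(postVar c.kf c.varf D.pt (x, w)))
  refine ⟨w, h.trans ?_⟩
  have : uF c D pstar x ≤ lF c D pstar x +
      2 * (√(beta c t) * √(postVar c.kf c.varf D.pt (x, w))) :=
    worstCase_le_add candidates_subset hA fun w' => by
      have := hw w'
      unfold uf lf
      linarith
  linarith

/-- As long as the algorithm has not stopped, the point it selects carries a large posterior
variance of `f` or of `g` for some value of the environmental variable. -/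
lemma exists_le_beta_mul_postVar [Nonempty X] [Nonempty Om] (hkf : (Matrix.of c.kf).PosSemidef)
    (hkg : (Matrix.of c.kg).PosSemidef) (hvarf : 0 < c.varf) (hvarg : 0 < c.varg)
    (hkg_le : ∀ z, c.kg z z ≤ 1) (hxi : 0 < c.xi)
    (hdelta : c.delta ∈ Set.Ioo (0 : ℝ) 1) (ht : 1 ≤ t)
    (hA : (candidates c t pstar).Nonempty) {x : X} (hx : x ∈ setH c D pstar ∪ setM c D pstar)
    (hmax : IsMaxOn (acq c D pstar) (setH c D pstar ∪ setM c D pstar) x)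
    (hS2 : ¬ stopS2 c D pstar) :
    ∃ w, min (c.xi ^ 4 / 4) (eta c ^ 2 / 4) ≤
      beta c t * (postVar c.kf c.varf D.pt (x, w) + postVar c.kg c.varg D.pt (x, w)) := by
  have hb := beta_nonneg (c := c) hdelta ht
  have hpf := fun w => postVar_nonneg hkf hvarf D.pt (x, w)
  have hpg := fun w => postVar_nonneg hkg hvarg D.pt (x, w)
  rcases hx with hx | hx
  · obtain ⟨w, hw⟩ := exists_le_width_of_le_uF_sub_lF hA
      (le_uF_sub_lF_of_mem_setH hA hxi hx hmax hS2)
    have hm0 : 0 < min 1 c.xi := lt_min one_pos hxi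
    have h1 := le_beta_mul_of_le_width hb (hpf w) (mul_pos hxi hm0).le hw
    refine ⟨w, ?_⟩
    have h2 : min (c.xi ^ 4 / 4) (eta c ^ 2 / 4) ≤ (c.xi * min 1 c.xi) ^ 2 / 4 := by
      rcases min_cases 1 c.xi with ⟨h, _⟩ | ⟨h, _⟩
      · -- for `ξ ≥ 1` the bound by `η ≤ ξ / 2` is the relevant one
        rw [h, mul_one]
        refine (min_le_right _ _).trans ?_
        have := eta_le hxi hkg_le
        have := eta_nonneg hxi hdelta
        gcongr
        linarith
      · rw [h]
        refine (min_le_left _ _).trans (le_of_eq ?_)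
        ring
    nlinarith [mul_nonneg hb (hpg w)]
  · obtain ⟨w, hw⟩ := exists_eta_le_width_of_mem_setM hxi hx
    have h1 := le_beta_mul_of_le_width hb (hpg w) (eta_nonneg hxi hdelta) hw
    refine ⟨w, (min_le_right _ _).trans ?_⟩
    nlinarith [mul_nonneg hb (hpf w)]

end Step

/-! ### Conditional expectations and realized values -/

section Concentration

lemma exp_neg_le_one_sub_half {x : ℝ} (h0 : 0 ≤ x) (h1 : x ≤ 1) : Real.exp (-x) ≤ 1 - x / 2 := by
  have h := convexOn_exp.2 (Set.mem_univ (-1)) (Set.mem_univ 0) h0 (sub_nonneg.2 h1) (by ring)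
  simp only [smul_eq_mul, mul_neg, mul_one, mul_zero, add_zero, Real.exp_zero] at h
  have h2 : Real.exp (-1) ≤ 1 / 2 := by
    rw [Real.exp_neg, one_div]
    exact inv_anti₀ two_pos (by linarith [Real.add_one_le_exp (1 : ℝ)])
  nlinarith

variable {Om : Type*} [Fintype Om] {p : Om → ℝ}

/-- One step of the exponential supermartingale, from `exp (-x) ≤ 1 - x / 2` on `[0, 1]`. -/
lemma sum_mul_exp_le_one (hp : p ∈ stdSimplex ℝ Om) {V : Om → ℝ} (h0 : ∀ o, 0 ≤ V o)
    (h1 : ∀ o, V o ≤ 1) : ∑ o, p o * Real.exp ((∑ o', p o' * V o') / 2 - V o) ≤ 1 := by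
  set m := ∑ o', p o' * V o' with hm
  calc ∑ o, p o * Real.exp (m / 2 - V o)
      ≤ ∑ o, Real.exp (m / 2) * (p o * (1 - V o / 2)) := by
        refine Finset.sum_le_sum fun o _ => ?_
        rw [sub_eq_add_neg, Real.exp_add]
        have := mul_le_mul_of_nonneg_left (exp_neg_le_one_sub_half (h0 o) (h1 o))
          (mul_nonneg (Real.exp_pos (m / 2)).le (hp.1 o))
        linarith
    _ = Real.exp (m / 2) * (1 - m / 2) := by
        rw [← Finset.mul_sum]
        congr 1
        simp_rw [mul_sub, mul_one, ← mul_div_assoc]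
        rw [Finset.sum_sub_distrib, hp.2, hm, Finset.sum_div]
    _ ≤ Real.exp (m / 2) * Real.exp (-(m / 2)) := by
        gcongr
        linarith [Real.add_one_le_exp (-(m / 2))]
    _ = 1 := by rw [← Real.exp_add]; simp

variable {S : Type*} [mS : MeasurableSpace S] [MeasurableSpace Om] [DiscreteMeasurableSpace Om]
  {P : Measure S} [IsProbabilityMeasure P]

/-- If `w t` is drawn from `p` independently of the past `F t`, and `V t o ∈ [0, 1]` is known before
trial `t`, the exponentials of `∑ (E[V t (w t) | F t] / 2 - V t (w t))` have mean at most one. -/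
lemma lintegral_exp_compensated_le_one (hp : p ∈ stdSimplex ℝ Om) {F : ℕ → MeasurableSpace S}
    (hF : ∀ t, F t ≤ mS) (hmono : Monotone F) {w : ℕ → S → Om}
    (hwF : ∀ t, Measurable[F (t + 1)] (w t))
    (hlaw : ∀ t o, P (w t ⁻¹' {o}) = ENNReal.ofReal (p o))
    (hind : ∀ t, Indep (F t) (MeasurableSpace.comap (w t) inferInstance) P)
    {V : ℕ → Om → S → ℝ} (hV : ∀ t o, Measurable[F t] (V t o))
    (h0 : ∀ t o s, 0 ≤ V t o s) (h1 : ∀ t o s, V t o s ≤ 1) (N : ℕ) :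
    Measurable[F N] (fun s => ENNReal.ofReal (Real.exp
      (∑ t ∈ Finset.range N, ((∑ o, p o * V t o s) / 2 - V t (w t s) s)))) ∧
    ∫⁻ s, ENNReal.ofReal (Real.exp
      (∑ t ∈ Finset.range N, ((∑ o, p o * V t o s) / 2 - V t (w t s) s))) ∂P ≤ 1 := by
  classical
  induction N with
  | zero => simp
  | succ N ih =>
    obtain ⟨ihm, ihi⟩ := ih
    set Y : S → ℝ≥0∞ := fun s => ENNReal.ofReal (Real.exp
      (∑ t ∈ Finset.range N, ((∑ o, p o * V t o s) / 2 - V t (w t s) s))) with hY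
    set g : Om → S → ℝ≥0∞ := fun o s =>
      Y s * ENNReal.ofReal (Real.exp ((∑ o', p o' * V N o' s) / 2 - V N o s)) with hg
    have hgm : ∀ o, Measurable[F N] (g o) := by
      intro o
      have h1 : Measurable[F N] fun s => (∑ o', p o' * V N o' s) / 2 - V N o s :=
        ((Finset.measurable_sum _ fun o' _ => (hV N o').const_mul _).div_const 2).sub (hV N o)
      exact ihm.mul (Real.measurable_exp.comp h1).ennreal_ofReal
    have hset : ∀ o, MeasurableSet[MeasurableSpace.comap (w N) inferInstance] (w N ⁻¹' {o}) :=
      fun o => ⟨{o}, MeasurableSet.of_discrete, rfl⟩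
    -- splitting over the values of `w N` reduces the induction step to independence
    have hdec : (fun s => ENNReal.ofReal (Real.exp
        (∑ t ∈ Finset.range (N + 1), ((∑ o, p o * V t o s) / 2 - V t (w t s) s)))) =
        fun s => ∑ o, g o s * (w N ⁻¹' {o}).indicator (fun _ => 1) s := by
      ext s
      rw [Finset.sum_eq_single (w N s)]
      · simp only [hg, hY, Finset.sum_range_succ, Real.exp_add]
        rw [ENNReal.ofReal_mul (Real.exp_pos _).le]
        simp
      · intro o _ ho
        have : s ∉ w N ⁻¹' {o} := fun h => ho h.symm
        simp [this]
      · simp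
    have hwN : Measurable (w N) := (hwF N).mono (hF _) le_rfl
    rw [hdec]
    refine ⟨?_, ?_⟩
    · refine Finset.measurable_sum _ fun o _ => ?_
      refine ((hgm o).mono (hmono N.le_succ) le_rfl).mul ?_
      exact measurable_const.indicator (hwF N MeasurableSet.of_discrete)
    · rw [lintegral_finsetSum (f := fun o s => g o s * (w N ⁻¹' {o}).indicator (fun _ => 1) s) _
        fun o _ => ((hgm o).mono (hF _) le_rfl).mul
          (measurable_const.indicator (hwN MeasurableSet.of_discrete))]
      have hprod : ∀ o, ∫⁻ s, g o s * (w N ⁻¹' {o}).indicator (fun _ => 1) s ∂P =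
          ∫⁻ s, g o s * ENNReal.ofReal (p o) ∂P := by
        intro o
        rw [lintegral_mul_eq_lintegral_mul_lintegral_of_independent_measurableSpace (hF N)
          hwN.comap_le (hind N) (hgm o)
          (Measurable.indicator (m := MeasurableSpace.comap (w N) inferInstance)
            measurable_const (hset o)),
          lintegral_mul_const _ ((hgm o).mono (hF _) le_rfl),
          lintegral_indicator_const (hwN MeasurableSet.of_discrete), hlaw, one_mul]
      rw [Finset.sum_congr rfl fun o _ => hprod o, ← lintegral_finsetSum
        (f := fun o s => g o s * ENNReal.ofReal (p o)) _
        fun o _ => ((hgm o).mono (hF _) le_rfl).mul measurable_const]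
      refine (lintegral_mono fun s => ?_).trans ihi
      calc ∑ o, g o s * ENNReal.ofReal (p o)
          = Y s * ENNReal.ofReal
              (∑ o, p o * Real.exp ((∑ o', p o' * V N o' s) / 2 - V N o s)) := by
            rw [ENNReal.ofReal_sum_of_nonneg
              fun o _ => mul_nonneg (hp.1 o) (Real.exp_pos _).le, Finset.mul_sum]
            refine Finset.sum_congr rfl fun o _ => ?_
            rw [ENNReal.ofReal_mul (hp.1 o)]
            simp only [hg]
            ring
        _ ≤ Y s * 1 := by
            gcongr
            rw [ENNReal.ofReal_le_one]
            exact sum_mul_exp_le_one hp (fun o => h0 N o s) (fun o => h1 N o s)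
        _ = Y s := mul_one _

/-- With probability at least `1 - δ`, the sum of conditional expectations is at most twice the
realized sum, up to `2 log (1 / δ)`. -/
lemma exists_event_sum_condExp_le (hp : p ∈ stdSimplex ℝ Om) {F : ℕ → MeasurableSpace S}
    (hF : ∀ t, F t ≤ mS) (hmono : Monotone F) {w : ℕ → S → Om}
    (hwF : ∀ t, Measurable[F (t + 1)] (w t))
    (hlaw : ∀ t o, P (w t ⁻¹' {o}) = ENNReal.ofReal (p o))
    (hind : ∀ t, Indep (F t) (MeasurableSpace.comap (w t) inferInstance) P)
    {V : ℕ → Om → S → ℝ} (hV : ∀ t o, Measurable[F t] (V t o))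
    (h0 : ∀ t o s, 0 ≤ V t o s) (h1 : ∀ t o s, V t o s ≤ 1) (N : ℕ) {δ : ℝ} (hδ : 0 < δ) :
    ∃ E : Set S, MeasurableSet E ∧ ENNReal.ofReal (1 - δ) ≤ P E ∧ ∀ s ∈ E,
      ∑ t ∈ Finset.range N, ∑ o, p o * V t o s ≤
        2 * ∑ t ∈ Finset.range N, V t (w t s) s + 2 * Real.log (1 / δ) := by
  obtain ⟨hm, hi⟩ := lintegral_exp_compensated_le_one hp hF hmono hwF hlaw hind hV h0 h1 N
  replace hm := hm.mono (hF N) le_rfl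
  set Y : S → ℝ≥0∞ := fun s => ENNReal.ofReal (Real.exp
    (∑ t ∈ Finset.range N, ((∑ o, p o * V t o s) / 2 - V t (w t s) s))) with hY
  have hbad : MeasurableSet {s | ENNReal.ofReal (1 / δ) ≤ Y s} :=
    measurableSet_le measurable_const hm
  refine ⟨{s | ENNReal.ofReal (1 / δ) ≤ Y s}ᶜ, hbad.compl, ?_, fun s hs => ?_⟩
  · have hM := mul_meas_ge_le_lintegral₀ (μ := P) hm.aemeasurable (ENNReal.ofReal (1 / δ))
    have hPb : P {s | ENNReal.ofReal (1 / δ) ≤ Y s} ≤ ENNReal.ofReal δ := by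
      have h2 := mul_le_mul_right (hM.trans hi) (ENNReal.ofReal δ)
      rwa [← mul_assoc, ← ENNReal.ofReal_mul hδ.le, mul_one_div_cancel hδ.ne',
        ENNReal.ofReal_one, one_mul, mul_one] at h2
    rw [prob_compl_eq_one_sub hbad, ENNReal.ofReal_sub _ hδ.le, ENNReal.ofReal_one]
    exact tsub_le_tsub_left hPb 1
  · have h2 : Y s < ENNReal.ofReal (1 / δ) := not_le.1 hs
    rw [hY, ENNReal.ofReal_lt_ofReal_iff (by positivity),
      ← Real.lt_log_iff_exp_lt (by positivity), Finset.sum_sub_distrib, ← Finset.sum_div] at h2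
    linarith

end Concentration

/-! ### The past of a trial -/

section Past

variable {S X Om U : Type*} [MeasurableSpace Om] [MeasurableSpace U]

/-- The sources that can influence the data of the first `t` trials. -/
def pastSources (t : ℕ) : Set Source := fun j =>
  match j with
  | .latent => True
  | .seed => True
  | .env i => i < t
  | .noiseF i => i < t
  | .noiseG i => i < t

lemma pastSources_mono : Monotone pastSources := by
  intro s t hst j hj
  cases j <;> first | trivial | exact lt_of_lt_of_le (show _ < s from hj) hst

variable (f g : X × Om → S → ℝ) (seed : S → U) (w : ℕ → S → Om) (ef eg : ℕ → S → ℝ)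

/-- The sigma-algebra generated by all sources of the first `t` trials. -/
@[reducible]
def pastSigma (t : ℕ) : MeasurableSpace S :=
  ⨆ j ∈ pastSources t, sourceSigma f g seed w ef eg j

lemma pastSigma_mono : Monotone (pastSigma f g seed w ef eg) := fun _ _ hst =>
  biSup_mono fun _ hj => pastSources_mono hst hj

variable {f g seed w ef eg}

lemma sourceSigma_le_pastSigma {t : ℕ} {j : Source} (hj : j ∈ pastSources t) :
    sourceSigma f g seed w ef eg j ≤ pastSigma f g seed w ef eg t :=
  le_biSup (sourceSigma f g seed w ef eg) hj

/-- Evaluating a countable random field at a random index is measurable. -/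
lemma measurable_apply_random {ι : Type*} [MeasurableSpace ι] [Countable ι]
    [MeasurableSingletonClass ι] {m : MeasurableSpace S} {F : ι → S → ℝ}
    (hF : ∀ z, Measurable (F z)) {z : S → ι} (hz : Measurable z) :
    Measurable fun s => F (z s) s :=
  (measurable_from_prod_countable_right (f := fun q : ι × S => F q.1 q.2) hF).comp
    (hz.prodMk measurable_id)

/-- The design points depend only on the sources of the past trials. -/
lemma measurable_designPoint [Finite X] [Finite Om] [MeasurableSpace X]
    [DiscreteMeasurableSpace X] [DiscreteMeasurableSpace Om] {x : ℕ → S → X}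
    (hx : ∀ t, Measurable[dataSigma f g seed w ef eg x t] (x t)) (t : ℕ) :
    Measurable[pastSigma f g seed w ef eg t] (x t) := by
  induction t using Nat.strong_induction_on with
  | _ t ih =>
    have hw : ∀ i : Fin t, Measurable[pastSigma f g seed w ef eg t] (w i) := fun i =>
      (comap_measurable (w i)).mono (sourceSigma_le_pastSigma (j := .env i) i.2) le_rfl
    have hef : ∀ i : Fin t, Measurable[pastSigma f g seed w ef eg t] (ef i) := fun i =>
      (comap_measurable (ef i)).mono (sourceSigma_le_pastSigma (j := .noiseF i) i.2) le_rfl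
    have heg : ∀ i : Fin t, Measurable[pastSigma f g seed w ef eg t] (eg i) := fun i =>
      (comap_measurable (eg i)).mono (sourceSigma_le_pastSigma (j := .noiseG i) i.2) le_rfl
    have hseed : Measurable[pastSigma f g seed w ef eg t] seed :=
      (comap_measurable seed).mono (sourceSigma_le_pastSigma (j := .seed) trivial) le_rfl
    have hfg : Measurable[pastSigma f g seed w ef eg t]
        (fun s => ((fun z => f z s), (fun z => g z s))) :=
      (comap_measurable _).mono (sourceSigma_le_pastSigma (j := .latent) trivial) le_rfl
    have hf : ∀ z, Measurable[pastSigma f g seed w ef eg t] (f z) := fun z =>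
      (measurable_pi_apply z).comp (measurable_fst.comp hfg)
    have hg : ∀ z, Measurable[pastSigma f g seed w ef eg t] (g z) := fun z =>
      (measurable_pi_apply z).comp (measurable_snd.comp hfg)
    have hxi : ∀ i : Fin t, Measurable[pastSigma f g seed w ef eg t] (x i) := fun i =>
      (ih i i.2).mono (pastSigma_mono f g seed w ef eg i.2.le) le_rfl
    have hz : ∀ i : Fin t, Measurable[pastSigma f g seed w ef eg t] fun s => (x i s, w i s) :=
      fun i => (hxi i).prodMk (hw i)
    refine (hx t).mono (Measurable.comap_le ?_) le_rfl
    let _ : MeasurableSpace S := pastSigma f g seed w ef eg t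
    refine hseed.prodMk (Measurable.prodMk ?_ (Measurable.prodMk ?_ ?_))
    · exact measurable_pi_lambda _ hz
    · exact measurable_pi_lambda _ fun i => (measurable_apply_random hf (hz i)).add (hef i)
    · exact measurable_pi_lambda _ fun i => (measurable_apply_random hg (hz i)).add (heg i)

variable [mS : MeasurableSpace S] {P : Measure S}

lemma sourceSigma_le {c : Params X Om} {pdag : Om → ℝ}
    (h : UncontrollableModel c pdag P f g seed w ef eg) (j : Source) :
    sourceSigma f g seed w ef eg j ≤ mS := by
  cases j with
  | latent =>
    exact (Measurable.prodMk (measurable_pi_lambda _ h.gp_f.measurable)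
      (measurable_pi_lambda _ h.gp_g.measurable)).comap_le
  | seed => exact h.measurable_seed.comap_le
  | env t => exact (h.measurable_w t).comap_le
  | noiseF t => exact (h.measurable_ef t).comap_le
  | noiseG t => exact (h.measurable_eg t).comap_le

lemma indep_pastSigma {c : Params X Om} {pdag : Om → ℝ}
    (h : UncontrollableModel c pdag P f g seed w ef eg) (t : ℕ) :
    Indep (pastSigma f g seed w ef eg t) (MeasurableSpace.comap (w t) inferInstance) P := by
  have hd : Disjoint (pastSources t) {Source.env t} := by
    rw [Set.disjoint_singleton_right]
    exact fun h => lt_irrefl t h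
  have := indep_iSup_of_disjoint (sourceSigma_le h) h.indep hd
  simpa using this

end Past

/-! ### The sample-size condition -/

section Budget

variable {X Om : Type*} {pdag : Om → ℝ}

lemma constC2_mul_eq (hpmin : 0 < pMin pdag) (v : ℝ≥0) (κ : ℝ) :
    pMin pdag * (constC2 pdag v * κ) = 2 * (2 / Real.log (1 + (v : ℝ)⁻¹) * κ) := by
  unfold constC2
  field_simp
  ring

/-- The constant `C₃` absorbs the deviation term and one extra trial. -/
lemma le_constC3 {c : Params X Om} (hpmin : 0 < pMin pdag) (hdelta : c.delta ∈ Set.Ioo (0 : ℝ) 1) :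
    4 + 4 * Real.log (1 / c.delta) ≤ pMin pdag * constC3 pdag c.delta := by
  obtain ⟨h0, h1⟩ := hdelta
  have h5 : (1 : ℝ) ≤ Real.log 5 := by
    rw [Real.le_log_iff_exp_le (by norm_num)]
    linarith [Real.exp_one_lt_d9]
  have hl : 0 ≤ Real.log (1 / c.delta) := Real.log_nonneg (by rw [one_le_div h0]; exact h1.le)
  have h : Real.log (5 / c.delta) = Real.log 5 + Real.log (1 / c.delta) := by
    rw [← Real.log_mul (by norm_num) (by positivity)]
    ring_nf
  have : pMin pdag * constC3 pdag c.delta = 16 * Real.log (5 / c.delta) := by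
    unfold constC3
    field_simp
  rw [this, h]
  linarith

/-- Under the sample-size condition, the posterior variances cannot stay large on average through
`T²` trials. -/
lemma not_budgetSuffices_of_sum_ge [Fintype X] [Fintype Om] [DecidableEq X] [DecidableEq Om]
    [Nonempty X] [Nonempty Om] {c : Params X Om} (hpmin : 0 < pMin pdag)
    (hdelta : c.delta ∈ Set.Ioo (0 : ℝ) 1) {T : ℕ} (hT : 0 < T)
    {m If Ig : ℝ}
    (hf : If ≤ 2 / Real.log (1 + (c.varf : ℝ)⁻¹) * (T * maxInfoGain c.kf c.varf T))
    (hg : Ig ≤ 2 / Real.log (1 + (c.varg : ℝ)⁻¹) * (T * maxInfoGain c.kg c.varg T))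
    (hm : m = min (c.xi ^ 4 / 4) (eta c ^ 2 / 4))
    (h : (T : ℝ) ^ 2 * (pMin pdag * m) ≤
      beta c (T ^ 2) * (2 * (If + Ig) + 4 + 4 * Real.log (1 / c.delta))) :
    ¬ BudgetSuffices c pdag T := by
  have hT' : (1 : ℝ) ≤ T := by exact_mod_cast hT
  have hb : 0 ≤ beta c (T ^ 2) := beta_nonneg hdelta (Nat.one_le_pow _ _ hT)
  unfold BudgetSuffices
  rw [← hm, not_lt, le_div_iff₀ (by linarith)]
  set κf := maxInfoGain c.kf c.varf T
  set κg := maxInfoGain c.kg c.varg T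
  set C := constC2 pdag c.varf * κf + constC2 pdag c.varg * κg + constC3 pdag c.delta with hC
  have h3 := le_constC3 (pdag := pdag) (c := c) hpmin hdelta
  have h4 : 0 ≤ pMin pdag * constC3 pdag c.delta := by
    refine le_trans ?_ h3
    have : 0 ≤ Real.log (1 / c.delta) := Real.log_nonneg (by
      rw [one_le_div hdelta.1]; exact hdelta.2.le)
    positivity
  have e1 := constC2_mul_eq hpmin c.varf κf
  have e2 := constC2_mul_eq hpmin c.varg κg
  have h5 : 2 * (If + Ig) + 4 + 4 * Real.log (1 / c.delta) ≤ T * (pMin pdag * C) := by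
    have h6 : pMin pdag * constC3 pdag c.delta ≤ T * (pMin pdag * constC3 pdag c.delta) :=
      le_mul_of_one_le_left h4 hT'
    have e3 : (T : ℝ) * (pMin pdag * C) =
        2 * (2 / Real.log (1 + (c.varf : ℝ)⁻¹) * (T * κf)) +
        2 * (2 / Real.log (1 + (c.varg : ℝ)⁻¹) * (T * κg)) +
        T * (pMin pdag * constC3 pdag c.delta) := by
      rw [hC, mul_add, mul_add (pMin pdag), e1, e2]
      ring
    rw [e3]
    linarith
  have h6 := h.trans (mul_le_mul_of_nonneg_left h5 hb)
  have hTp : 0 < (T : ℝ) * pMin pdag := by positivity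
  refine le_of_mul_le_mul_left ?_ hTp
  linarith

end Budget

end DRCCBO

end

/-! ### Termination -/

open DRCCBO

theorem theorem3 {X Om S U : Type*}
    [Fintype X] [Fintype Om] [DecidableEq X] [DecidableEq Om] [Nonempty X] [Nonempty Om]
    [MeasurableSpace X] [DiscreteMeasurableSpace X]
    [MeasurableSpace Om] [DiscreteMeasurableSpace Om] [MeasurableSpace U]
    [MeasurableSpace S] (P : Measure S) [IsProbabilityMeasure P]
    -- the inputs of the algorithm
    (c : DRCCBO.Params X Om)
    (hkf : (Matrix.of c.kf).PosSemidef) (hkg : (Matrix.of c.kg).PosSemidef)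
    (hvarf : 0 < c.varf) (hvarg : 0 < c.varg)
    (hkf_le : ∀ z, c.kf z z ≤ 1) (hkg_le : ∀ z, c.kg z z ≤ 1)
    (hkg_pos : 0 < DRCCBO.sigmaGMinSq c)
    (halpha : c.alpha ∈ Set.Ioo (0 : ℝ) 1) (hxi : 0 < c.xi)
    (hdelta : c.delta ∈ Set.Ioo (0 : ℝ) 1)
    (hdist : ∀ p ∈ stdSimplex ℝ Om, c.dist p p = 0) (heps : ∀ t, 0 < c.eps t)
    -- the true distribution of the environmental variables
    (pdag : Om → ℝ) (hpdag : pdag ∈ stdSimplex ℝ Om) (hpmin : 0 < DRCCBO.pMin pdag)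
    -- the random functions, the environmental variables and the noises
    (f g : X × Om → S → ℝ) (seed : S → U) (w : ℕ → S → Om) (ef eg : ℕ → S → ℝ)
    (hmodel : DRCCBO.UncontrollableModel c pdag P f g seed w ef eg)
    -- the reference distributions, which may depend on the data, and the design points
    (pstar : ℕ → S → Om → ℝ) (hpstar : ∀ t s, pstar t s ∈ stdSimplex ℝ Om)
    (x : ℕ → S → X) (hrun : DRCCBO.IsRun c f g seed w ef eg x pstar)
    (T : ℕ) (hT : IsLeast {n : ℕ | 0 < n ∧ DRCCBO.BudgetSuffices c pdag n} T) :
    ∃ E : Set S, MeasurableSet E ∧ ENNReal.ofReal (1 - c.delta) ≤ P E ∧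
      ∀ s ∈ E, ∃ t, 1 ≤ t ∧ t ≤ T ^ 2 ∧ DRCCBO.StopsAt c f g w ef eg x pstar t s := by
  obtain ⟨hT0, hbudget⟩ := hT.1
  -- the posterior variances at the design point of a trial, before the environment is drawn
  set pf : ℕ → Om → S → ℝ := fun t o s =>
    postVar c.kf c.varf (fun i : Fin t => (x i s, w i s)) (x t s, o) with hpf
  set pg : ℕ → Om → S → ℝ := fun t o s =>
    postVar c.kg c.varg (fun i : Fin t => (x i s, w i s)) (x t s, o) with hpg
  have hpf0 : ∀ t o s, 0 ≤ pf t o s := fun t o s => postVar_nonneg hkf hvarf _ _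
  have hpg0 : ∀ t o s, 0 ≤ pg t o s := fun t o s => postVar_nonneg hkg hvarg _ _
  have hpf1 : ∀ t o s, pf t o s ≤ 1 := fun t o s => (postVar_le hkf hvarf _ _).trans (hkf_le _)
  have hpg1 : ∀ t o s, pg t o s ≤ 1 := fun t o s => (postVar_le hkg hvarg _ _).trans (hkg_le _)
  have hx := measurable_designPoint hrun.adapted
  have hw : ∀ t, Measurable[pastSigma f g seed w ef eg (t + 1)] (w t) := fun t =>
    (comap_measurable (w t)).mono (sourceSigma_le_pastSigma (j := .env t) t.lt_succ_self) le_rfl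
  have hmono := pastSigma_mono f g seed w ef eg
  have hV : ∀ t o, Measurable[pastSigma f g seed w ef eg t]
      fun s => (pf t o s + pg t o s) / 2 := by
    intro t o
    have hpts : Measurable[pastSigma f g seed w ef eg t]
        fun s => ((fun i : Fin t => (x i s, w i s)), x t s) := by
      let _ : MeasurableSpace S := pastSigma f g seed w ef eg t
      refine (measurable_pi_lambda _ fun i : Fin t => Measurable.prodMk ?_ ?_).prodMk (hx t)
      · exact (hx i).mono (hmono i.2.le) le_rfl
      · exact (hw i).mono (hmono i.2) le_rfl
    exact (measurable_of_countable fun q : (Fin t → X × Om) × X =>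
      (postVar c.kf c.varf q.1 (q.2, o) + postVar c.kg c.varg q.1 (q.2, o)) / 2).comp hpts
  obtain ⟨E, hE, hPE, hsum⟩ := exists_event_sum_condExp_le hpdag
    (fun t => iSup₂_le fun j _ => sourceSigma_le hmodel j) hmono hw hmodel.law_w
    (indep_pastSigma hmodel) hV
    (fun t o s => by linarith [hpf0 t o s, hpg0 t o s])
    (fun t o s => by linarith [hpf1 t o s, hpg1 t o s]) (T ^ 2 + 1) hdelta.1
  refine ⟨E, hE, hPE, fun s hs => ?_⟩
  by_contra! hcon
  set m := min (c.xi ^ 4 / 4) (eta c ^ 2 / 4) with hm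
  -- the conditional expectations are bounded below while the algorithm runs
  have hstep : ∀ t ∈ Finset.range (T ^ 2),
      pMin pdag * m ≤ beta c (T ^ 2) * ∑ o, pdag o * (pf (t + 1) o s + pg (t + 1) o s) := by
    intro t ht
    have htT : t + 1 ≤ T ^ 2 := Finset.mem_range.1 ht
    have ht1 : 1 ≤ t + 1 := Nat.le_add_left 1 t
    have hrunning : ∀ r, 1 ≤ r → r ≤ t + 1 → ¬ StopsAt c f g w ef eg x pstar r s :=
      fun r h1 h2 => hcon r h1 (h2.trans htT)
    obtain ⟨o, ho⟩ := exists_le_beta_mul_postVar hkf hkg hvarf hvarg hkg_le hxi hdelta ht1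
      (candidates_nonempty hdist heps (hpstar (t + 1) s)) (hrun.mem _ s ht1 hrunning)
      (hrun.maximizes _ s ht1 hrunning) fun h => hcon _ ht1 htT (Or.inr h)
    change m ≤ beta c (t + 1) * (pf (t + 1) o s + pg (t + 1) o s) at ho
    have hq0 : ∀ o, 0 ≤ pf (t + 1) o s + pg (t + 1) o s := fun o =>
      add_nonneg (hpf0 _ _ _) (hpg0 _ _ _)
    have hb := beta_mono (c := c) hdelta ht1 htT
    have hb0 := beta_nonneg (c := c) hdelta (ht1.trans htT)
    have hpo : pMin pdag ≤ pdag o := ciInf_le (Set.finite_range _).bddBelow o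
    calc pMin pdag * m
        ≤ pMin pdag * (beta c (T ^ 2) * (pf (t + 1) o s + pg (t + 1) o s)) :=
          mul_le_mul_of_nonneg_left (ho.trans (mul_le_mul_of_nonneg_right hb (hq0 o))) hpmin.le
      _ ≤ pdag o * (beta c (T ^ 2) * (pf (t + 1) o s + pg (t + 1) o s)) :=
          mul_le_mul_of_nonneg_right hpo (mul_nonneg hb0 (hq0 o))
      _ = beta c (T ^ 2) * (pdag o * (pf (t + 1) o s + pg (t + 1) o s)) := by ring
      _ ≤ _ := mul_le_mul_of_nonneg_left (Finset.single_le_sum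
          (f := fun o => pdag o * (pf (t + 1) o s + pg (t + 1) o s))
          (fun o _ => mul_nonneg (hpdag.1 o) (hq0 o)) (Finset.mem_univ o)) hb0
  have hlow := Finset.sum_le_sum hstep
  rw [Finset.sum_const, Finset.card_range, nsmul_eq_mul, ← Finset.mul_sum] at hlow
  push_cast at hlow
  -- In the bound on the good event, the term of `t = 0` is dropped on the left; on the right the
  -- term of `t = T²` costs at most `4`, so that exactly `T²` points enter the information gain.
  have hs' := hsum s hs
  have hhalf : ∀ t, ∑ o, pdag o * ((pf t o s + pg t o s) / 2) =
      (∑ o, pdag o * (pf t o s + pg t o s)) / 2 := fun t => by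
    rw [Finset.sum_div]
    exact Finset.sum_congr rfl fun o _ => by ring
  simp only [hhalf] at hs'
  rw [← Finset.sum_div, ← Finset.sum_div, Finset.sum_range_succ',
    Finset.sum_range_succ _ (T ^ 2), Finset.sum_add_distrib (f := fun t => pf t (w t s) s)] at hs'
  have h0 : 0 ≤ ∑ o, pdag o * (pf 0 o s + pg 0 o s) :=
    Finset.sum_nonneg fun o _ => mul_nonneg (hpdag.1 o) (add_nonneg (hpf0 _ _ _) (hpg0 _ _ _))
  have hlast1 := hpf1 (T ^ 2) (w (T ^ 2) s) s
  have hlast2 := hpg1 (T ^ 2) (w (T ^ 2) s) s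
  refine not_budgetSuffices_of_sum_ge hpmin hdelta hT0
    (sum_postVar_le hkf hvarf hkf_le (fun t => (x t s, w t s)) T)
    (sum_postVar_le hkg hvarg hkg_le (fun t => (x t s, w t s)) T) hm
    (hlow.trans (mul_le_mul_of_nonneg_left ?_
      (beta_nonneg hdelta (Nat.one_le_pow _ _ hT0)))) hbudget
  change _ ≤ 2 * (∑ t ∈ Finset.range (T ^ 2), pf t (w t s) s +
    ∑ t ∈ Finset.range (T ^ 2), pg t (w t s) s) + 4 + 4 * Real.log (1 / c.delta)
  linarith
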